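/- Let $x_0,x_1,x_2,\dots$ be a sequence of real random variables on a probability space that satisfies one of the following assumptions: (A1) the $x_i$ are independent and uniformly bounded, with mean $0$ and variance $1$; (A2) the $x_i$ are i.i.d. with mean $0$ and variance $1$; (A3) the $x_i$ are independent with mean $0$ and variance $1$, and $\sup_i \mathbb{E}|x_i|^k<\infty$ for every $k\ge 1$. For $n\ge 1$ let $SC_n=\big(x_{L(i,j)}\big)_{1\le i,j\le n}$ be the Symmetric Circulant matrix, where $L(i,j)=\frac n2-\big|\frac n2-|i-j|\big|$, and let $PT_n=\big(x_{L'(i,j)}\big)_{1\le i,j\le n}$ be the symmetric Palindromic Toeplitz matrix, with first row $(x_0,x_1,x_2,\dots,x_2,x_1,x_0)$, that is, $L'(i,j)=\min\{|i-j|,\,n-1-|i-j|\}$. Let $S_n=(s_{ij})_{1\le i,j\le n}$ with $s_{ij}=1$ if $i<j$, $s_{ii}=0$, and $s_{ij}=-1$ if $i>j$, and let $\widetilde{SC}_n=S_n\odot SC_n$ and $\widetilde{PT}_n=S_n\odot PT_n$ (entrywise products). For a real skew-symmetric $n\times n$ matrix $A$ with eigenvalues $\lambda_1,\dots,\lambda_n$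 (all purely imaginary, listed with multiplicity), let $F^A(t)=\frac1n\#\{j: \mathrm{i}\lambda_j\le t\}$ for $t\in\mathbb{R}$. Then $n^{-1/2}\widetilde{SC}_n$ and $n^{-1/2}\widetilde{PT}_n$ both have limiting spectral distribution $\mathcal N(0,1)$ almost surely. That is, with $\Phi$ the distribution function of $\mathcal N(0,1)$, outside a null set, as $n\to\infty$, $F^{n^{-1/2}\widetilde{SC}_n}(t)\to\Phi(t)$ and $F^{n^{-1/2}\widetilde{PT}_n}(t)\to\Phi(t)$ for all $t\in\mathbb{R}$. -/

import Mathlib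

open Filter Topology MeasureTheory ProbabilityTheory
open scoped Matrix

namespace SkewLSD

/-! ### Assumptions on the input sequence -/

/-- The part common to all three assumptions: `x 0, x 1, x 2, …` are independent, square integrable
real random variables with mean `0` and variance `1`. -/
structure IsInput {Ω : Type*} [MeasurableSpace Ω] (P : Measure Ω) (x : ℕ → Ω → ℝ) : Prop where
  measurable : ∀ i, Measurable (x i)
  indep : iIndepFun x P
  memLp_two : ∀ i, MemLp (x i) 2 P
  mean_zero : ∀ i, ∫ ω, x i ω ∂P = 0
  variance_one : ∀ i, variance (x i) P = 1

/-- (A1): independent, uniformly bounded, mean `0`, variance `1`. -/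
def A1 {Ω : Type*} [MeasurableSpace Ω] (P : Measure Ω) (x : ℕ → Ω → ℝ) : Prop :=
  IsInput P x ∧ ∃ C : ℝ, ∀ i, ∀ᵐ ω ∂P, |x i ω| ≤ C

/-- (A2): independent and identically distributed, mean `0`, variance `1`. -/
def A2 {Ω : Type*} [MeasurableSpace Ω] (P : Measure Ω) (x : ℕ → Ω → ℝ) : Prop :=
  IsInput P x ∧ ∀ i j, IdentDistrib (x i) (x j) P P

/-- (A3): independent, mean `0`, variance `1`, and for every order `k` the absolute moments of
order `k` are finite and bounded uniformly over the sequence (the bound may depend on `k`). -/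
def A3 {Ω : Type*} [MeasurableSpace Ω] (P : Measure Ω) (x : ℕ → Ω → ℝ) : Prop :=
  IsInput P x ∧ ∀ k : ℕ, ∃ C : ℝ, ∀ i,
    Integrable (fun ω => |x i ω| ^ k) P ∧ ∫ ω, |x i ω| ^ k ∂P ≤ C

/-! ### Patterned matrices and their skew-symmetric versions

Rows and columns are indexed by `Fin n = {0, …, n - 1}` instead of `{1, …, n}`; the link functions
below depend on `|i - j|` only, so this shift changes nothing. -/

/-- `|i - j|`. -/
def gap {n : ℕ} (i j : Fin n) : ℕ := ((i : ℤ) - (j : ℤ)).natAbs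

/-- Link function of the Symmetric Circulant matrix, `n/2 - |n/2 - |i - j||`. -/
def linkSC (n : ℕ) (i j : Fin n) : ℕ := min (gap i j) (n - gap i j)

/-- Link function of the (symmetric) Palindromic Toeplitz matrix, whose first row is the palindrome
`x₀, x₁, x₂, …, x₂, x₁, x₀`. -/
def linkPT (n : ℕ) (i j : Fin n) : ℕ := min (gap i j) (n - 1 - gap i j)

theorem gap_lt {n : ℕ} (i j : Fin n) : gap i j < n := by
  unfold gap; omega

theorem linkSC_eq (n : ℕ) (i j : Fin n) :
    (linkSC n i j : ℝ) = (n : ℝ) / 2 - abs ((n : ℝ) / 2 - abs ((i : ℝ) - (j : ℝ))) := by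
  have hg : ((gap i j : ℕ) : ℝ) = |(i : ℝ) - (j : ℝ)| := by
    unfold gap; rw [Nat.cast_natAbs]; push_cast; rfl
  rw [linkSC, ← hg, Nat.cast_min, Nat.cast_sub (gap_lt i j).le]
  rcases le_total ((gap i j : ℕ) : ℝ) ((n : ℝ) / 2) with h | h
  · rw [abs_of_nonneg (by linarith), min_eq_left (by linarith)]; ring
  · rw [abs_of_nonpos (by linarith), min_eq_right (by linarith)]; ring

/-- The first row of the Palindromic Toeplitz pattern is a palindrome. -/
theorem linkPT_palindrome (n : ℕ) (j : Fin (n + 1)) :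
    linkPT (n + 1) 0 j = linkPT (n + 1) 0 j.rev := by
  have hj := j.isLt
  simp only [linkPT, gap, Fin.val_rev, Fin.val_zero]
  omega

/-- The patterned matrix `((a_{L(i,j)}))` with link function `L` and input sequence `a`. -/
def patterned {n : ℕ} (L : Fin n → Fin n → ℕ) (a : ℕ → ℝ) : Matrix (Fin n) (Fin n) ℝ :=
  Matrix.of fun i j => a (L i j)

/-- The sign matrix `S_n`: `0` on, `1` above and `-1` below the diagonal. -/
def signMatrix (n : ℕ) : Matrix (Fin n) (Fin n) ℝ :=
  Matrix.of fun i j => if i = j then 0 else if j < i then -1 else 1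

/-- The skew-symmetric version `S_n ⊙ A_n` of a (symmetric) matrix. -/
noncomputable def skew {n : ℕ} (A : Matrix (Fin n) (Fin n) ℝ) : Matrix (Fin n) (Fin n) ℝ :=
  signMatrix n ⊙ A

/-- `n^{-1/2}` times the skew-symmetric Symmetric Circulant matrix. -/
noncomputable def scaledSkewSC (a : ℕ → ℝ) (n : ℕ) : Matrix (Fin n) (Fin n) ℝ :=
  (Real.sqrt n)⁻¹ • skew (patterned (linkSC n) a)

/-- `n^{-1/2}` times the skew-symmetric Palindromic Toeplitz matrix. -/
noncomputable def scaledSkewPT (a : ℕ → ℝ) (n : ℕ) : Matrix (Fin n) (Fin n) ℝ :=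
  (Real.sqrt n)⁻¹ • skew (patterned (linkPT n) a)

/-! ### Spectral distributions of skew-symmetric matrices -/

/-- The complex eigenvalues of a real square matrix, with algebraic multiplicity. -/
noncomputable def eigs {n : ℕ} (A : Matrix (Fin n) (Fin n) ℝ) : Multiset ℂ :=
  (A.map (fun t : ℝ => (t : ℂ))).charpoly.roots

/-- The empirical spectral distribution function of a real skew-symmetric matrix:
`F^A(x) = (1/n) #{j : i λ_j ≤ x}`, where `λ_1, …, λ_n` are the eigenvalues. They are purely
imaginary, so that each `i λ_j` is real and equals its real part. -/
noncomputable def skewESD {n : ℕ} (A : Matrix (Fin n) (Fin n) ℝ) (x : ℝ) : ℝ :=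
  ((eigs A).countP (fun l => (Complex.I * l).re ≤ x) : ℝ) / n

/-- The random skew-symmetric matrices `A n` have limiting spectral distribution `ν`: almost surely,
`F^{A_n}(x) → F(x)` at all continuity points `x` of the distribution function `F` of `ν`. -/
def HasLSD {Ω : Type*} [MeasurableSpace Ω] (P : Measure Ω)
    (A : (n : ℕ) → Ω → Matrix (Fin n) (Fin n) ℝ) (ν : Measure ℝ) : Prop :=
  ∀ᵐ ω ∂P, ∀ x : ℝ, ContinuousAt (fun y => cdf ν y) x →
    Tendsto (fun n : ℕ => skewESD (A n ω) x) atTop (𝓝 (cdf ν x))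

end SkewLSD

/-!
The skew-symmetric version of the symmetric circulant matrix of size `n` is negacyclic: its entry at
`(i, j)` depends on `j - i` modulo `n` up to a sign that changes with each wrap-around. Hence the
vectors `(ζ ^ j)_j` with `ζ ^ n = -1` are eigenvectors (`sum_skew_linkSC_mul_pow`), and the rotated
scaled eigenvalues are explicit linear forms `T k = ∑ m, coef k m * x m` in the input, with
`coef k m` equal to `-2 / √n * sin (π (2 k + 1) m / n)` up to boundary terms
(`skewESD_scaledSkewSC`). By orthogonality of the sines, the matrix `coef` has operator norm at most
`√2` (`sum_sq_coef_le`), while its rows have Euclidean norm `1 + O(1 / n)`, except for the middle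
row when `n` is odd, which vanishes (`sum_coef_sq_le_one`).

It remains to show that almost surely the empirical characteristic function
`(1 / n) ∑ k, exp (i s T k)` tends to `exp (-s ^ 2 / 2)` for all `s`; Lévy's theorem then gives the
convergence of the distribution functions.

* *Means.* Uniformly over the nonzero rows, `T k` satisfies Lindeberg's condition, so that
  `E exp (i s T k)` is close to `exp (-s ^ 2 / 2)` (`norm_charFun_point_sub_le`).
* *Truncation.* By the operator norm bound, truncating the variables changes the empirical
  characteristic function by at most a multiple of the root mean square of the tails, which is
  small in the mean and almost surely (`TailControl`): by the strong law under (A2), and by moment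
  bounds under (A1) and (A3).
* *Concentration.* For bounded input and a smooth function `φ`, let `F = (1 / n) ∑ k, φ (T k)`.
  Setting the variables to `0` one at a time changes `F` by amounts whose squares sum to `O(1 / n)`
  (`sum_sq_specMean_update_le`): the gradient is bounded by the operator norm of `coef`, and the
  second order terms are small because `coef k m ^ 2 ≤ 4 / n`. The Efron–Stein inequality, applied
  first to `F` and then to `(F - E F) ^ 2`, shows that the fourth central moment of `F` is
  `O(1 / n ^ 2)` (`fourth_moment_le`), which is summable.

The palindromic Toeplitz pattern of size `n + 1` contains the symmetric circulant pattern of size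
`n` as its leading principal submatrix. By Cauchy interlacing the two eigenvalue counting functions
differ by at most `1` (`countP_eigs_submatrix`), and the ratio of the scalings tends to `1`.
-/

namespace SkewLSD

/-! ### The Efron–Stein inequality and fourth moments -/

theorem integrable_of_abs_le {Ω : Type*} [MeasurableSpace Ω] {P : Measure Ω} [IsFiniteMeasure P]
    {f : Ω → ℝ} (hf : Measurable f) {B : ℝ} (hB : ∀ ω, |f ω| ≤ B) : Integrable f P :=
  Integrable.of_bound hf.aestronglyMeasurable B (ae_of_all _ fun ω => by simpa using hB ω)

/-- Centring at any constant can only increase the second moment. -/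
theorem integral_sq_sub_le {Ω : Type*} [MeasurableSpace Ω] {P : Measure Ω} [IsProbabilityMeasure P]
    {f : Ω → ℝ} (hf : Integrable f P) (hf2 : Integrable (fun ω => f ω ^ 2) P) (c : ℝ) :
    ∫ ω, f ω ^ 2 ∂P - (∫ ω, f ω ∂P) ^ 2 ≤ ∫ ω, (f ω - c) ^ 2 ∂P := by
  have h : ∫ ω, (f ω - c) ^ 2 ∂P = ∫ ω, f ω ^ 2 ∂P - 2 * c * (∫ ω, f ω ∂P) + c ^ 2 := by
    have : (fun ω => (f ω - c) ^ 2) = fun ω => (f ω ^ 2 - 2 * c * f ω) + c ^ 2 := by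
      ext ω; ring
    have h2 : Integrable (fun ω => f ω ^ 2 - 2 * c * f ω) P := hf2.sub (hf.const_mul _)
    rw [this, integral_add h2 (integrable_const _),
      integral_sub hf2 (hf.const_mul _), integral_const_mul]
    simp
  rw [h]
  nlinarith [sq_nonneg ((∫ ω, f ω ∂P) - c)]

theorem sq_integral_le {Ω : Type*} [MeasurableSpace Ω] {P : Measure Ω} [IsProbabilityMeasure P]
    {f : Ω → ℝ} (hf : Integrable f P) (hf2 : Integrable (fun ω => f ω ^ 2) P) :
    (∫ ω, f ω ∂P) ^ 2 ≤ ∫ ω, f ω ^ 2 ∂P := by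
  have h := variance_nonneg f P
  rw [variance_eq_sub ((memLp_two_iff_integrable_sq hf.aestronglyMeasurable).2 hf2)] at h
  simpa using h

/-- The **Efron–Stein inequality** for bounded functions of independent variables. In place of an
independent copy, each variable is replaced by a fixed reference point `a`; this suffices because
the conditional variance is at most the mean square distance to any value that does not depend on
that variable. The proof is by induction on the number of variables. -/
theorem efron_stein {α : Type*} [MeasurableSpace α] (a : α) : ∀ (N : ℕ)
    (μ : Fin N → Measure α) [∀ i, IsProbabilityMeasure (μ i)]
    (F : (Fin N → α) → ℝ) (_ : Measurable F) (B : ℝ) (_ : ∀ y, |F y| ≤ B),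
    ∫ y, F y ^ 2 ∂(Measure.pi μ) - (∫ y, F y ∂(Measure.pi μ)) ^ 2 ≤
      ∑ d, ∫ y, (F y - F (Function.update y d a)) ^ 2 ∂(Measure.pi μ)
  | 0, μ, _, F, hF, B, hB => by
    have : ∀ y : Fin 0 → α, F y = F (fun i => i.elim0) := fun y => by
      congr 1; exact Subsingleton.elim _ _
    simp [this]
  | N + 1, μ, _, F, hF, B, hB => by
    set ν : Measure (Fin N → α) := Measure.pi (fun j => μ j.succ) with hν
    have mp : MeasurePreserving (fun q : α × (Fin N → α) => (Fin.cons q.1 q.2 : Fin (N+1) → α))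
        ((μ 0).prod ν) (Measure.pi μ) := by
      have := (measurePreserving_piFinSuccAbove μ 0).symm
      convert! this using 2
      simp [MeasurableEquiv.piFinSuccAbove, Fin.insertNthEquiv]
    have hme : MeasurableEmbedding
        (fun q : α × (Fin N → α) => (Fin.cons q.1 q.2 : Fin (N+1) → α)) := by
      have := (MeasurableEquiv.piFinSuccAbove (fun _ : Fin (N+1) => α) 0).symm.measurableEmbedding
      convert! this using 2
      simp [MeasurableEquiv.piFinSuccAbove, Fin.insertNthEquiv]
    have key : ∀ G : (Fin (N+1) → α) → ℝ, Measurable G → ∀ K : ℝ, (∀ y, |G y| ≤ K) →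
        ∫ y, G y ∂(Measure.pi μ) = ∫ b, ∫ y, G (Fin.cons b y) ∂ν ∂(μ 0) := by
      intro G hG K hK
      rw [← mp.integral_comp hme]
      exact integral_prod (fun q : α × (Fin N → α) => G (Fin.cons q.1 q.2))
        (integrable_of_abs_le (hG.comp mp.measurable) fun ω => hK _)
    have sqb : ∀ u v : ℝ, |u| ≤ B → |v| ≤ B → |(u - v) ^ 2| ≤ (2 * B) ^ 2 := by
      intro u v hu hv
      rw [abs_pow]
      exact pow_le_pow_left₀ (abs_nonneg _) ((abs_sub _ _).trans (by linarith)) 2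
    have hupd : ∀ d : Fin (N+1), Measurable fun y : Fin (N+1) → α => F (Function.update y d a) :=
      fun d => hF.comp measurable_update_left
    have hcons : ∀ b, Measurable fun y : Fin N → α => F (Fin.cons b y) := fun b =>
      hF.comp (mp.measurable.comp measurable_prodMk_left)
    have hcons2 : Measurable fun q : α × (Fin N → α) => F (Fin.cons q.1 q.2) :=
      hF.comp mp.measurable
    set h : α → ℝ := fun b => ∫ y, F (Fin.cons b y) ∂ν with hh
    have hhm : Measurable h := (hcons2.stronglyMeasurable.integral_prod_right').measurable
    have hhb : ∀ b, |h b| ≤ B := by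
      intro b
      have := norm_integral_le_of_norm_le_const (μ := ν) (f := fun y => F (Fin.cons b y)) (C := B)
        (ae_of_all _ fun y => by simpa using hB _)
      simpa using this
    have pw : ∀ u : ℝ, |u| ≤ B → |u ^ 2| ≤ B ^ 2 := fun u hu => by
      rw [abs_pow]; exact pow_le_pow_left₀ (abs_nonneg _) hu 2
    have i2 : Integrable (fun b => ∫ y, F (Fin.cons b y) ^ 2 ∂ν) (μ 0) := by
      have : Integrable (fun q : α × (Fin N → α) => F (Fin.cons q.1 q.2) ^ 2) ((μ 0).prod ν) :=
        integrable_of_abs_le (hcons2.pow_const 2) fun q => pw _ (hB _)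
      exact this.integral_prod_left
    have ih2 : Integrable (fun b => h b ^ 2) (μ 0) :=
      integrable_of_abs_le (hhm.pow_const 2) fun q => pw _ (hhb _)
    have ih1 : Integrable h (μ 0) := integrable_of_abs_le hhm hhb
    -- the variance splits into the mean conditional variance and the variance of the mean
    have split : ∫ y, F y ^ 2 ∂(Measure.pi μ) - (∫ y, F y ∂(Measure.pi μ)) ^ 2
        = ∫ b, (∫ y, F (Fin.cons b y) ^ 2 ∂ν - h b ^ 2) ∂(μ 0)
          + (∫ b, h b ^ 2 ∂(μ 0) - (∫ b, h b ∂(μ 0)) ^ 2) := by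
      rw [key (fun y => F y ^ 2) (hF.pow_const 2) (B ^ 2) (fun y => pw _ (hB _)),
        key F hF B hB, integral_sub i2 ih2]
      ring
    have isucc : ∀ d : Fin N, Integrable (fun b => ∫ y, (F (Fin.cons b y) -
        F (Fin.cons b (Function.update y d a))) ^ 2 ∂ν) (μ 0) := by
      intro d
      have hm : Measurable fun q : α × (Fin N → α) =>
          F (Fin.cons q.1 (Function.update q.2 d a)) :=
        hcons2.comp (measurable_fst.prodMk (measurable_update_left.comp measurable_snd))
      have : Integrable (fun q : α × (Fin N → α) => (F (Fin.cons q.1 q.2) -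
        F (Fin.cons q.1 (Function.update q.2 d a))) ^ 2) ((μ 0).prod ν) :=
        integrable_of_abs_le ((hcons2.sub hm).pow_const 2) fun q => sqb _ _ (hB _) (hB _)
      exact this.integral_prod_left
    have first : ∫ b, (∫ y, F (Fin.cons b y) ^ 2 ∂ν - h b ^ 2) ∂(μ 0)
        ≤ ∑ d : Fin N, ∫ y, (F y - F (Function.update y d.succ a)) ^ 2 ∂(Measure.pi μ) := by
      have e : ∀ d : Fin N, ∫ y, (F y - F (Function.update y d.succ a)) ^ 2 ∂(Measure.pi μ)
          = ∫ b, ∫ y, (F (Fin.cons b y) - F (Fin.cons b (Function.update y d a))) ^ 2 ∂ν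
            ∂(μ 0) := by
        intro d
        rw [key (fun y => (F y - F (Function.update y d.succ a)) ^ 2)
          ((hF.sub (hupd _)).pow_const 2) _ (fun y => sqb _ _ (hB _) (hB _))]
        simp only [Fin.cons_update]
      rw [Finset.sum_congr rfl fun d _ => e d, ← integral_finsetSum _ fun d _ => isucc d]
      refine integral_mono (i2.sub ih2) (integrable_finsetSum _ fun d _ => isucc d) fun b => ?_
      exact efron_stein a N (fun j => μ j.succ) (fun y => F (Fin.cons b y)) (hcons b) B
        (fun y => hB _)
    have second : ∫ b, h b ^ 2 ∂(μ 0) - (∫ b, h b ∂(μ 0)) ^ 2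
        ≤ ∫ y, (F y - F (Function.update y 0 a)) ^ 2 ∂(Measure.pi μ) := by
      refine (integral_sq_sub_le ih1 ih2 (h a)).trans ?_
      rw [key (fun y => (F y - F (Function.update y 0 a)) ^ 2)
        ((hF.sub (hupd _)).pow_const 2) _ (fun y => sqb _ _ (hB _) (hB _))]
      simp only [Fin.update_cons_zero]
      have hm : Measurable fun q : α × (Fin N → α) => F (Fin.cons a q.2) :=
        (hcons a).comp measurable_snd
      have hi : Integrable (fun q : α × (Fin N → α) => (F (Fin.cons q.1 q.2) -
          F (Fin.cons a q.2)) ^ 2) ((μ 0).prod ν) :=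
        integrable_of_abs_le ((hcons2.sub hm).pow_const 2) fun q => sqb _ _ (hB _) (hB _)
      refine integral_mono ?_ hi.integral_prod_left fun b => ?_
      · exact integrable_of_abs_le ((hhm.sub_const _).pow_const 2)
          fun q => sqb _ _ (hhb _) (hhb _)
      · have : h b - h a = ∫ y, (F (Fin.cons b y) - F (Fin.cons a y)) ∂ν :=
          (integral_sub (integrable_of_abs_le (hcons b) fun _ => hB _)
            (integrable_of_abs_le (hcons a) fun _ => hB _)).symm
        simp only [this]
        exact sq_integral_le
          (integrable_of_abs_le (B := 2 * B) ((hcons b).sub (hcons a))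
            fun y => (abs_sub _ _).trans (by linarith [hB (Fin.cons b y), hB (Fin.cons a y)]))
          (integrable_of_abs_le (((hcons b).sub (hcons a)).pow_const 2)
            fun y => sqb _ _ (hB _) (hB _))
    rw [split, Fin.sum_univ_succ]
    linarith

/-- If replacing the variables by `a` one at a time changes `F` by amounts whose squares sum to at
most `V`, then the fourth central moment of `F` is `O(V ^ 2)`. The Efron–Stein inequality is applied
to `F`, which bounds its variance, and then to the square of the centred `F`. -/
theorem fourth_moment_le {α : Type*} [MeasurableSpace α] (a : α) {N : ℕ}
    (μ : Fin N → Measure α) [∀ i, IsProbabilityMeasure (μ i)]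
    {F : (Fin N → α) → ℝ} (hF : Measurable F) {B : ℝ} (hB : ∀ y, |F y| ≤ B) {V : ℝ}
    (s : Set α) (hs : ∀ i, ∀ᵐ t ∂(μ i), t ∈ s)
    (hV : ∀ y, (∀ i, y i ∈ s) → ∑ d, (F y - F (Function.update y d a)) ^ 2 ≤ V) :
    ∫ y, (F y - ∫ z, F z ∂(Measure.pi μ)) ^ 4 ∂(Measure.pi μ) ≤ 11 * V ^ 2 := by
  set M := ∫ z, F z ∂(Measure.pi μ) with hM
  have hMB : |M| ≤ B := by
    have := norm_integral_le_of_norm_le_const (μ := Measure.pi μ) (f := F) (C := B)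
        (ae_of_all _ fun y => by simpa using hB _)
    simpa using this
  set u : (Fin N → α) → ℝ := fun y => F y - M with hu
  have hum : Measurable u := hF.sub_const _
  have hub : ∀ y, |u y| ≤ 2 * B := fun y => (abs_sub _ _).trans (by linarith [hB y])
  have hupd : ∀ d, Measurable fun y : Fin N → α => u (Function.update y d a) :=
    fun d => hum.comp measurable_update_left
  have pw : ∀ (v K : ℝ) (n : ℕ), |v| ≤ K → |v ^ n| ≤ K ^ n := fun v K n hv => by
    rw [abs_pow]; exact pow_le_pow_left₀ (abs_nonneg _) hv n
  have hall : ∀ᵐ y ∂(Measure.pi μ), ∀ i, y i ∈ s := by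
    rw [eventually_all]
    intro i
    exact (measurePreserving_eval μ i).quasiMeasurePreserving.ae (hs i)
  have hdu : ∀ y d, u y - u (Function.update y d a) = F y - F (Function.update y d a) :=
    fun y d => by simp [hu]
  have dbd : ∀ y d, |u y - u (Function.update y d a)| ≤ 4 * B := fun y d =>
    (abs_sub _ _).trans (by linarith [hub y, hub (Function.update y d a)])
  have hi1 : ∀ d, Integrable (fun y => (u y - u (Function.update y d a)) ^ 2) (Measure.pi μ) :=
    fun d => integrable_of_abs_le ((hum.sub (hupd d)).pow_const 2) fun y => pw _ _ 2 (dbd y d)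
  have hsum1 : ∑ d, ∫ y, (u y - u (Function.update y d a)) ^ 2 ∂(Measure.pi μ) ≤ V := by
    rw [← integral_finsetSum _ fun d _ => hi1 d]
    calc _ ≤ ∫ y, V ∂(Measure.pi μ) := by
          refine integral_mono_ae (integrable_finsetSum _ fun d _ => hi1 d)
            (integrable_const _) ?_
          filter_upwards [hall] with y hy
          simp only [hdu]
          exact hV y hy
      _ = V := by simp
  have hu0 : ∫ y, u y ∂(Measure.pi μ) = 0 := by
    simp only [hu]
    rw [integral_sub (integrable_of_abs_le hF hB) (integrable_const _)]
    simp [hM]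
  have hvar : ∫ y, u y ^ 2 ∂(Measure.pi μ) ≤ V := by
    have := efron_stein a N μ u hum _ hub
    rw [hu0] at this
    linarith
  have hv0 : 0 ≤ ∫ y, u y ^ 2 ∂(Measure.pi μ) := integral_nonneg fun y => sq_nonneg _
  have iu2 : Integrable (fun y => u y ^ 2) (Measure.pi μ) :=
    integrable_of_abs_le (hum.pow_const 2) fun y => pw _ _ 2 (hub y)
  have hG := efron_stein a N μ (fun y => u y ^ 2) (hum.pow_const 2) _ (fun y => pw _ _ 2 (hub y))
  have hi2 : ∀ d, Integrable (fun y => (u y ^ 2 - u (Function.update y d a) ^ 2) ^ 2)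
      (Measure.pi μ) := fun d => integrable_of_abs_le (B := (2 * (2 * B) ^ 2) ^ 2)
        (((hum.pow_const 2).sub ((hupd d).pow_const 2)).pow_const 2) fun y =>
          pw _ _ 2 ((abs_sub _ _).trans (by
            linarith [pw _ _ 2 (hub y), pw _ _ 2 (hub (Function.update y d a))]))
  have hsum2 : ∑ d, ∫ y, (u y ^ 2 - u (Function.update y d a) ^ 2) ^ 2 ∂(Measure.pi μ)
      ≤ 8 * V * V + 2 * V ^ 2 := by
    rw [← integral_finsetSum _ fun d _ => hi2 d]
    calc _ ≤ ∫ y, (8 * V * u y ^ 2 + 2 * V ^ 2) ∂(Measure.pi μ) := by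
          refine integral_mono_ae (integrable_finsetSum _ fun d _ => hi2 d)
            ((iu2.const_mul _).add (integrable_const _)) ?_
          filter_upwards [hall] with y hy
          have h1 := hV y hy
          have h2 : ∀ d, (u y ^ 2 - u (Function.update y d a) ^ 2) ^ 2 ≤
              (8 * u y ^ 2 + 2 * V) * (F y - F (Function.update y d a)) ^ 2 := by
            intro d
            rw [← hdu]
            set e := u y - u (Function.update y d a) with he
            have e1 : u (Function.update y d a) = u y - e := by rw [he]; ring
            have e2 : e ^ 2 ≤ V := by
              rw [he, hdu]
              exact (Finset.single_le_sum (f := fun d => (F y - F (Function.update y d a)) ^ 2)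
                (fun _ _ => sq_nonneg _) (Finset.mem_univ d)).trans h1
            rw [e1]
            have : (u y ^ 2 - (u y - e) ^ 2) ^ 2 = (2 * u y - e) ^ 2 * e ^ 2 := by ring
            rw [this]
            refine mul_le_mul_of_nonneg_right ?_ (sq_nonneg _)
            nlinarith [sq_nonneg (2 * u y + e)]
          have hVn : 0 ≤ V := (Finset.sum_nonneg fun d _ => sq_nonneg _).trans h1
          calc _ ≤ ∑ d, (8 * u y ^ 2 + 2 * V) * (F y - F (Function.update y d a)) ^ 2 :=
                Finset.sum_le_sum fun d _ => h2 d
            _ = (8 * u y ^ 2 + 2 * V) * ∑ d, (F y - F (Function.update y d a)) ^ 2 := by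
                rw [Finset.mul_sum]
            _ ≤ (8 * u y ^ 2 + 2 * V) * V :=
                mul_le_mul_of_nonneg_left h1 (by positivity)
            _ = _ := by ring
      _ = 8 * V * ∫ y, u y ^ 2 ∂(Measure.pi μ) + 2 * V ^ 2 := by
          rw [integral_add (iu2.const_mul _) (integrable_const _), integral_const_mul]; simp
      _ ≤ _ := by
          have hVn : 0 ≤ V := hv0.trans hvar
          gcongr
  have e4 : ∀ y, (u y ^ 2) ^ 2 = u y ^ 4 := fun y => by ring
  simp only [e4] at hG
  have : (∫ y, u y ^ 2 ∂(Measure.pi μ)) ^ 2 ≤ V ^ 2 := pow_le_pow_left₀ hv0 hvar 2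
  linarith

/-! ### Trigonometric sums and the coefficients of the spectrum -/

/-- The angle of the `k`-th root `exp (i π (2 k + 1) / n)` of `z ^ n = -1`. -/
noncomputable def angle (n k : ℕ) : ℝ := Real.pi * (2 * k + 1) / n

/-- The number of `d ∈ {1, …, n - 1}` with `min d (n - d) = m`. -/
def mult (n m : ℕ) : ℕ := if m = 0 then 0 else if 2 * m < n then 2 else if 2 * m = n then 1 else 0

/-- The coefficient of the input variable `x m` in the `k`-th point of the spectrum of
`scaledSkewSC`, rotated onto the real axis. -/
noncomputable def coef {n : ℕ} (k m : Fin n) : ℝ :=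
  -(Real.sqrt n)⁻¹ * (mult n m * Real.sin (angle n k * m))

/-- Summation over `{1, …, n - 1}` of a function of `min d (n - d)`, by folding at `n / 2`. -/
theorem sum_fold (n : ℕ) (G : ℕ → ℝ) :
    ∑ d ∈ Finset.range n, (if d = 0 then 0 else G (min d (n - d)))
      = ∑ m ∈ Finset.range n, mult n m * G m := by
  have h1 : ∀ d ∈ Finset.range n, (if d = 0 then 0 else G (min d (n - d))) =
      (if 0 < d ∧ 2 * d ≤ n then G d else 0) + (if 0 < d ∧ n < 2 * d then G (n - d) else 0) := by
    intro d _
    rcases Nat.eq_zero_or_pos d with h | h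
    · simp [h]
    · rcases le_or_gt (2 * d) n with h' | h'
      · rw [if_neg (by omega), if_pos ⟨h, h'⟩, if_neg (by omega), min_eq_left (by omega), add_zero]
      · rw [if_neg (by omega), if_neg (by omega), if_pos ⟨h, h'⟩, min_eq_right (by omega), zero_add]
  have h2 : ∀ m ∈ Finset.range n, (mult n m : ℝ) * G m =
      (if 0 < m ∧ 2 * m ≤ n then G m else 0) + (if 0 < m ∧ 2 * m < n then G m else 0) := by
    intro m _
    unfold mult
    rcases Nat.eq_zero_or_pos m with h | h
    · simp [h]
    · rcases lt_trichotomy (2 * m) n with h' | h' | h'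
      · rw [if_neg (by omega), if_pos h', if_pos ⟨h, h'.le⟩, if_pos ⟨h, h'⟩]; push_cast; ring
      · rw [if_neg (by omega), if_neg (by omega), if_pos h', if_pos ⟨h, h'.le⟩,
          if_neg (by omega)]; simp
      · rw [if_neg (by omega), if_neg (by omega), if_neg (by omega), if_neg (by omega),
          if_neg (by omega)]; simp
  rw [Finset.sum_congr rfl h1, Finset.sum_congr rfl h2, Finset.sum_add_distrib,
    Finset.sum_add_distrib]
  congr 1
  rw [← Finset.sum_filter, ← Finset.sum_filter]
  refine Finset.sum_nbij' (fun d => n - d) (fun d => n - d) ?_ ?_ ?_ ?_ ?_ <;>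
    simp only [Finset.mem_filter, Finset.mem_range]
  · intro a ha; omega
  · intro a ha; omega
  · intro a ha; omega
  · intro a ha; omega
  · intro a ha; trivial

theorem sum_cos_eq_zero {n : ℕ} {a : ℤ} (h : ¬ (n : ℤ) ∣ a) (φ : ℝ) :
    ∑ d ∈ Finset.range n, Real.cos (2 * Real.pi * a * d / n + φ) = 0 := by
  rcases Nat.eq_zero_or_pos n with hn | hn
  · simp [hn]
  have hn' : (n : ℂ) ≠ 0 := by exact_mod_cast hn.ne'
  set q : ℂ := Complex.exp (2 * Real.pi * a / n * Complex.I) with hq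
  have hqn : q ^ n = 1 := by
    rw [hq, ← Complex.exp_nat_mul, Complex.exp_eq_one_iff]
    exact ⟨a, by field_simp⟩
  have hq1 : q ≠ 1 := by
    intro h1
    rw [hq, Complex.exp_eq_one_iff] at h1
    obtain ⟨m, hm⟩ := h1
    apply h
    refine ⟨m, ?_⟩
    have hpi : (Real.pi : ℂ) ≠ 0 := by exact_mod_cast Real.pi_ne_zero
    have : (a : ℂ) = n * m := by
      have hI := Complex.I_ne_zero
      field_simp at hm
      linear_combination hm
    exact_mod_cast this
  have hsum : ∑ d ∈ Finset.range n, q ^ d = 0 := by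
    have := mul_neg_geom_sum q n
    rw [hqn, sub_self] at this
    exact (mul_eq_zero.1 this).resolve_left (sub_ne_zero.2 hq1.symm)
  have hre : ∀ d ∈ Finset.range n, Real.cos (2 * Real.pi * a * d / n + φ)
      = (Complex.exp (φ * Complex.I) * q ^ d).re := by
    intro d _
    rw [hq, ← Complex.exp_nat_mul, ← Complex.exp_add, ← Complex.exp_ofReal_mul_I_re]
    congr 2
    push_cast
    field_simp
    ring
  rw [Finset.sum_congr rfl hre, ← Complex.re_sum, ← Finset.mul_sum, hsum, mul_zero, Complex.zero_re]

/-- The angle `2 * angle n k` is a nontrivial multiple of `2 π / n` unless `2 * k + 1 = n`. -/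
theorem sum_sin_sq {n k : ℕ} (hk : k < n) (h : 2 * k + 1 ≠ n) :
    ∑ d ∈ Finset.range n, Real.sin (angle n k * d) ^ 2 = n / 2 := by
  have hd : ¬ (n : ℤ) ∣ ((2 * k + 1 : ℕ) : ℤ) := by
    rw [Int.natCast_dvd_natCast]
    rintro ⟨c, hc⟩
    rcases c with _ | _ | c
    · omega
    · omega
    · nlinarith
  have h0 := sum_cos_eq_zero hd 0
  have : ∀ d ∈ Finset.range n, Real.sin (angle n k * d) ^ 2 =
      1 / 2 - Real.cos (2 * Real.pi * ((2 * k + 1 : ℕ) : ℤ) * d / n + 0) / 2 := by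
    intro d _
    rw [Real.sin_sq_eq_half_sub]
    congr 3
    unfold angle
    push_cast
    ring
  rw [Finset.sum_congr rfl this, Finset.sum_sub_distrib,
    ← Finset.sum_div _
      (fun d : ℕ => Real.cos (2 * Real.pi * ((2 * k + 1 : ℕ) : ℤ) * d / n + 0)), h0]
  simp
  ring

/-- Bessel's inequality for the orthogonal vectors `(sin (angle n k * d))_k`, deduced from the
orthogonality of `(exp (i * angle n k * d))_k`. -/
theorem sum_sq_sin_le {n : ℕ} (u : ℕ → ℝ) :
    ∑ k ∈ Finset.range n, (∑ d ∈ Finset.range n, u d * Real.sin (angle n k * d)) ^ 2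
      ≤ n * ∑ d ∈ Finset.range n, u d ^ 2 := by
  rcases Nat.eq_zero_or_pos n with hn | hn
  · simp [hn]
  have hnr : (n : ℝ) ≠ 0 := by exact_mod_cast hn.ne'
  have h1 : ∀ k ∈ Finset.range n,
      (∑ d ∈ Finset.range n, u d * Real.sin (angle n k * d)) ^ 2 ≤
      ∑ d ∈ Finset.range n, ∑ e ∈ Finset.range n,
        u d * u e * Real.cos (angle n k * d - angle n k * e) := by
    intro k _
    have : ∑ d ∈ Finset.range n, ∑ e ∈ Finset.range n,
        u d * u e * Real.cos (angle n k * d - angle n k * e) =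
        (∑ d ∈ Finset.range n, u d * Real.cos (angle n k * d)) ^ 2 +
        (∑ d ∈ Finset.range n, u d * Real.sin (angle n k * d)) ^ 2 := by
      rw [sq, sq, Finset.sum_mul_sum, Finset.sum_mul_sum, ← Finset.sum_add_distrib]
      refine Finset.sum_congr rfl fun d _ => ?_
      rw [← Finset.sum_add_distrib]
      refine Finset.sum_congr rfl fun e _ => ?_
      rw [Real.cos_sub]; ring
    rw [this]
    nlinarith [sq_nonneg (∑ d ∈ Finset.range n, u d * Real.cos (angle n k * d))]
  refine (Finset.sum_le_sum h1).trans (le_of_eq ?_)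
  rw [Finset.sum_comm, Finset.mul_sum]
  refine Finset.sum_congr rfl fun d hd => ?_
  rw [Finset.sum_comm, Finset.sum_eq_single d]
  · simp only [sub_self, Real.cos_zero, mul_one, Finset.sum_const, Finset.card_range,
      nsmul_eq_mul]
    ring
  · intro e he hne
    rw [← Finset.mul_sum]
    have hdvd : ¬ (n : ℤ) ∣ ((d : ℤ) - e) := by
      intro hh
      rw [Finset.mem_range] at hd he
      have := Int.eq_zero_of_abs_lt_dvd hh (by rw [abs_lt]; omega)
      omega
    have := sum_cos_eq_zero hdvd (Real.pi * ((d : ℤ) - (e : ℤ) : ℤ) / n)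
    refine mul_eq_zero_of_right _ ?_
    rw [← this]
    refine Finset.sum_congr rfl fun k _ => ?_
    congr 1
    unfold angle
    push_cast
    field_simp
  · intro h; exact absurd hd h

theorem sin_angle_reflect {n k d : ℕ} (hd : d ≤ n) (hn : 0 < n) :
    Real.sin (angle n k * (n - d : ℕ)) = Real.sin (angle n k * d) := by
  have hnr : (n : ℝ) ≠ 0 := by exact_mod_cast hn.ne'
  have : angle n k * (n - d : ℕ) = (Real.pi - angle n k * d) + k * (2 * Real.pi) := by
    unfold angle
    rw [Nat.cast_sub hd]
    field_simp
    ring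
  rw [this, Real.sin_add_nat_mul_two_pi, Real.sin_pi_sub]

theorem sin_angle_min {n k d : ℕ} (hd : d < n) :
    Real.sin (angle n k * (min d (n - d) : ℕ)) = Real.sin (angle n k * d) := by
  rcases le_total d (n - d) with h | h
  · rw [min_eq_left h]
  · rw [min_eq_right h, sin_angle_reflect hd.le (by omega)]

theorem sum_coef_mul {n : ℕ} (k : Fin n) (z : ℕ → ℝ) :
    ∑ m : Fin n, coef k m * z m = -(Real.sqrt n)⁻¹ *
      ∑ d ∈ Finset.range n,
        (if d = 0 then 0 else z (min d (n - d))) * Real.sin (angle n k * d) := by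
  have h := sum_fold n (fun m => z m * Real.sin (angle n k * m))
  have h2 : ∀ d ∈ Finset.range n, (if d = 0 then 0 else z (min d (n - d))) *
      Real.sin (angle n k * d) = if d = 0 then 0 else
        (fun m : ℕ => z m * Real.sin (angle n k * m)) (min d (n - d)) := by
    intro d hd
    split_ifs
    · simp
    · simp only []
      rw [sin_angle_min (Finset.mem_range.1 hd)]
  rw [Finset.sum_congr rfl h2, h, Finset.mul_sum, Finset.sum_range]
  refine Finset.sum_congr rfl fun m _ => ?_
  unfold coef
  ring

theorem mult_le (n m : ℕ) : mult n m ≤ 2 := by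
  unfold mult; split_ifs <;> omega

theorem abs_coef_le {n : ℕ} (k m : Fin n) : |coef k m| ≤ 2 / Real.sqrt n := by
  unfold coef
  have h1 := Real.abs_sin_le_one (angle n k * m)
  have h2 : (mult n m : ℝ) ≤ 2 := by exact_mod_cast mult_le n m
  rw [abs_mul, abs_neg, abs_inv, abs_of_nonneg (Real.sqrt_nonneg _), abs_mul, Nat.abs_cast,
    div_eq_mul_inv, mul_comm]
  gcongr
  nlinarith [abs_nonneg (Real.sin (angle n k * m))]

theorem coef_sq_le {n : ℕ} (k m : Fin n) : coef k m ^ 2 ≤ 4 / n := by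
  have h := pow_le_pow_left₀ (abs_nonneg _) (abs_coef_le k m) 2
  rw [sq_abs, div_pow, Real.sq_sqrt (Nat.cast_nonneg n)] at h
  linarith

/-- The operator norm of `coef` is at most `√2`: folding uses each variable at most twice. -/
theorem sum_sq_coef_le {n : ℕ} (z : Fin n → ℝ) :
    ∑ k : Fin n, (∑ m, coef k m * z m) ^ 2 ≤ 2 * ∑ m, z m ^ 2 := by
  rcases Nat.eq_zero_or_pos n with hn | hn
  · subst hn; simp
  have hnr : (n : ℝ) ≠ 0 := by exact_mod_cast hn.ne'
  set w : ℕ → ℝ := fun m => if h : m < n then z ⟨m, h⟩ else 0 with hw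
  have hwz : ∀ m : Fin n, w m = z m := fun m => by simp [hw]
  simp only [← hwz]
  set u : ℕ → ℝ := fun d => if d = 0 then 0 else w (min d (n - d)) with hu
  have h1 : ∀ k : Fin n, (∑ m : Fin n, coef k m * w m) ^ 2 =
      (n : ℝ)⁻¹ * (∑ d ∈ Finset.range n, u d * Real.sin (angle n k * d)) ^ 2 := by
    intro k
    rw [sum_coef_mul, mul_pow, neg_sq, inv_pow, Real.sq_sqrt (Nat.cast_nonneg n)]
  rw [Finset.sum_congr rfl fun k _ => h1 k, ← Finset.mul_sum]
  have h2 := sum_sq_sin_le (n := n) u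
  rw [Finset.sum_range] at h2
  have h3 : ∑ d ∈ Finset.range n, u d ^ 2 ≤ 2 * ∑ m : Fin n, w m ^ 2 := by
    have : ∀ d ∈ Finset.range n, u d ^ 2 = if d = 0 then 0 else
        (fun m => w m ^ 2) (min d (n - d)) := by
      intro d _
      simp only [hu]
      split_ifs <;> simp
    rw [Finset.sum_congr rfl this, sum_fold n (fun m => w m ^ 2), Finset.mul_sum, ← Finset.sum_range
      (fun m => 2 * w m ^ 2)]
    refine Finset.sum_le_sum fun m _ => mul_le_mul_of_nonneg_right ?_ (sq_nonneg _)
    exact_mod_cast mult_le n m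
  calc _ ≤ (n : ℝ)⁻¹ * (n * ∑ d ∈ Finset.range n, u d ^ 2) := by gcongr
    _ = ∑ d ∈ Finset.range n, u d ^ 2 := by field_simp
    _ ≤ _ := h3

/-- The transpose of a matrix has the same operator norm. -/
theorem sum_sq_coef_transpose_le {n : ℕ} (b : Fin n → ℝ) :
    ∑ m : Fin n, (∑ k, b k * coef k m) ^ 2 ≤ 2 * ∑ k, b k ^ 2 := by
  set g : Fin n → ℝ := fun m => ∑ k, b k * coef k m with hg
  set S := ∑ m, g m ^ 2 with hS
  have hS0 : 0 ≤ S := Finset.sum_nonneg fun _ _ => sq_nonneg _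
  have h1 : S = ∑ k, b k * ∑ m, coef k m * g m := by
    simp only [hS, Finset.mul_sum]
    rw [Finset.sum_comm]
    refine Finset.sum_congr rfl fun m _ => ?_
    rw [sq]
    nth_rewrite 1 [hg]
    rw [Finset.sum_mul]
    exact Finset.sum_congr rfl fun k _ => by ring
  -- Cauchy–Schwarz and the bound for `coef` itself, applied to the image `g`
  have h2 : S ^ 2 ≤ (∑ k, b k ^ 2) * (2 * S) := by
    nth_rewrite 1 [h1]
    refine (Finset.sum_mul_sq_le_sq_mul_sq _ _ _).trans ?_
    exact mul_le_mul_of_nonneg_left (sum_sq_coef_le g) (Finset.sum_nonneg fun _ _ => sq_nonneg _)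
  rcases hS0.eq_or_lt with h | h
  · rw [← h]; exact mul_nonneg two_pos.le (Finset.sum_nonneg fun _ _ => sq_nonneg _)
  · nlinarith

/-- The rows of `coef` are almost unit vectors. The row with `2 * k + 1 = n` is excluded: its angle
is `π` and it vanishes. -/
theorem sum_coef_sq_le_one {n : ℕ} {k : Fin n} (hk : 2 * (k : ℕ) + 1 ≠ n) :
    ∑ m, coef k m ^ 2 ≤ 1 ∧ 1 - 1 / (n : ℝ) ≤ ∑ m, coef k m ^ 2 := by
  have hn : 0 < n := k.pos
  have hnr : (0 : ℝ) < n := by exact_mod_cast hn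
  have h := sum_fold n (fun m => Real.sin (angle n k * m) ^ 2)
  have h2 : ∀ d ∈ Finset.range n, (if d = 0 then 0 else
      (fun m : ℕ => Real.sin (angle n k * m) ^ 2) (min d (n - d)))
      = Real.sin (angle n k * d) ^ 2 := by
    intro d hd
    split_ifs with h0
    · simp [h0]
    · simp only []
      rw [sin_angle_min (Finset.mem_range.1 hd)]
  rw [Finset.sum_congr rfl h2, sum_sin_sq k.isLt hk, Finset.sum_range] at h
  have e : ∀ m : Fin n, coef k m ^ 2 =
      (n : ℝ)⁻¹ * ((mult n m : ℝ) ^ 2 * Real.sin (angle n k * m) ^ 2) := by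
    intro m
    unfold coef
    rw [mul_pow, neg_sq, inv_pow, Real.sq_sqrt (Nat.cast_nonneg n), mul_pow]
  rw [Finset.sum_congr rfl fun m _ => e m, ← Finset.mul_sum]
  constructor
  · have : ∑ m : Fin n, (mult n m : ℝ) ^ 2 * Real.sin (angle n k * m) ^ 2 ≤
        ∑ m : Fin n, 2 * ((mult n m : ℝ) * Real.sin (angle n k * m) ^ 2) := by
      refine Finset.sum_le_sum fun m _ => ?_
      rw [← mul_assoc]
      refine mul_le_mul_of_nonneg_right ?_ (sq_nonneg _)
      have : (mult n m : ℝ) ≤ 2 := by exact_mod_cast mult_le n m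
      nlinarith [(Nat.cast_nonneg (mult n m) : (0 : ℝ) ≤ _)]
    rw [← Finset.mul_sum, ← h] at this
    calc _ ≤ (n : ℝ)⁻¹ * (2 * (n / 2)) := by gcongr
      _ = 1 := by field_simp
  · have : ∑ m : Fin n, (2 * ((mult n m : ℝ) * Real.sin (angle n k * m) ^ 2) -
        if 2 * (m : ℕ) = n then 1 else 0) ≤
        ∑ m : Fin n, (mult n m : ℝ) ^ 2 * Real.sin (angle n k * m) ^ 2 := by
      refine Finset.sum_le_sum fun m _ => ?_
      have hs := Real.sin_sq_le_one (angle n k * m)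
      unfold mult
      split_ifs <;> first | omega | (push_cast; nlinarith [sq_nonneg (Real.sin (angle n k * m))])
    rw [Finset.sum_sub_distrib, ← Finset.mul_sum, ← h] at this
    have hc : ∑ m : Fin n, (if 2 * (m : ℕ) = n then (1 : ℝ) else 0) ≤ 1 := by
      rw [Finset.sum_boole]
      have : (Finset.univ.filter fun m : Fin n => 2 * (m : ℕ) = n).card ≤ 1 := by
        rw [Finset.card_le_one]
        intro a ha b hb
        simp only [Finset.mem_filter] at ha hb
        ext
        omega
      exact_mod_cast this
    calc 1 - 1 / (n : ℝ) = (n : ℝ)⁻¹ * (2 * (n / 2) - 1) := by field_simp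
      _ ≤ _ := by gcongr; linarith

/-! ### Concentration of linear spectral statistics -/

/-- The average of `φ` over the points `∑ m, coef k m * z m`, i.e. the linear spectral statistic
of `φ` as a function of the input variables. -/
noncomputable def specMean (φ : ℝ → ℝ) {n : ℕ} (z : Fin n → ℝ) : ℝ :=
  (n : ℝ)⁻¹ * ∑ k : Fin n, φ (∑ m, coef k m * z m)

theorem measurable_specMean {φ : ℝ → ℝ} (hφ : Measurable φ) {n : ℕ} :
    Measurable (specMean φ (n := n)) := by
  unfold specMean
  refine Measurable.const_mul (Finset.measurable_sum _ fun k _ => hφ.comp ?_) _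
  exact Finset.measurable_sum _ fun m _ => (measurable_pi_apply m).const_mul _

theorem abs_specMean_le {φ : ℝ → ℝ} (hφ : ∀ t, |φ t| ≤ 1) {n : ℕ} (z : Fin n → ℝ) :
    |specMean φ z| ≤ 1 := by
  unfold specMean
  rcases Nat.eq_zero_or_pos n with hn | hn
  · subst hn; simp
  have hnr : (0 : ℝ) < n := by exact_mod_cast hn
  rw [abs_mul, abs_inv, Nat.abs_cast]
  have : |∑ k : Fin n, φ (∑ m, coef k m * z m)| ≤ n := by
    refine (Finset.abs_sum_le_sum_abs _ _).trans ?_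
    refine (Finset.sum_le_sum fun k _ => hφ _).trans ?_
    simp
  calc _ ≤ (n : ℝ)⁻¹ * n := by gcongr
    _ = 1 := by field_simp

/-- Setting the variables to zero one at a time changes a smooth linear spectral statistic by
amounts whose squares add up to `O(1 / n)`: the first order terms are controlled by Bessel's
inequality, and each of the `n` second order terms is `O(1 / n)`. -/
theorem sum_sq_specMean_update_le {φ φ' : ℝ → ℝ} {K : ℝ} (hφ' : ∀ t, |φ' t| ≤ K)
    (hT : ∀ a b, |φ a - φ b - φ' a * (a - b)| ≤ K * (a - b) ^ 2) {n : ℕ} {C : ℝ}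
    (z : Fin n → ℝ) (hz : ∀ m, |z m| ≤ C) :
    ∑ d, (specMean φ z - specMean φ (Function.update z d 0)) ^ 2
      ≤ K ^ 2 * (4 * C ^ 2 + 32 * C ^ 4) / n := by
  rcases Nat.eq_zero_or_pos n with hn | hn
  · subst hn; simp
  have hnr : (0 : ℝ) < n := by exact_mod_cast hn
  have hK : 0 ≤ K := (abs_nonneg _).trans (hφ' 0)
  set T : Fin n → ℝ := fun k => ∑ m, coef k m * z m with hTdef
  have hupd : ∀ d k, ∑ m, coef k m * Function.update z d 0 m = T k - coef k d * z d := by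
    intro d k
    have : ∀ m, coef k m * Function.update z d 0 m =
        coef k m * z m - if m = d then coef k m * z m else 0 := by
      intro m
      by_cases h : m = d
      · subst h; simp
      · simp [h]
    rw [Finset.sum_congr rfl fun m _ => this m, Finset.sum_sub_distrib]
    simp [hTdef]
  set g : Fin n → ℝ := fun d => ∑ k, φ' (T k) * coef k d with hg
  have hzsq : ∀ d, z d ^ 2 ≤ C ^ 2 := fun d => by
    rw [← sq_abs]; exact pow_le_pow_left₀ (abs_nonneg _) (hz d) 2
  have hone : ∀ d, (specMean φ z - specMean φ (Function.update z d 0)) ^ 2 ≤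
      (n : ℝ)⁻¹ ^ 2 * (2 * C ^ 2 * g d ^ 2 + 2 * (4 * K * C ^ 2) ^ 2) := by
    intro d
    -- the first order part of the increment is `z d * g d`, the rest is `R`
    set R : ℝ := ∑ k, (φ (T k) - φ (T k - coef k d * z d) - φ' (T k) * (coef k d * z d)) with hR
    have h1 : specMean φ z - specMean φ (Function.update z d 0) = (n : ℝ)⁻¹ * (z d * g d + R) := by
      unfold specMean
      simp only [hupd]
      rw [← mul_sub, hR, hg, Finset.mul_sum, ← Finset.sum_add_distrib, ← Finset.sum_sub_distrib]
      congr 1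
      exact Finset.sum_congr rfl fun k _ => by ring
    have h2 : |R| ≤ 4 * K * C ^ 2 := by
      refine (Finset.abs_sum_le_sum_abs _ _).trans ?_
      have : ∀ k ∈ Finset.univ, |φ (T k) - φ (T k - coef k d * z d) - φ' (T k) * (coef k d * z d)|
          ≤ K * (4 / n * C ^ 2) := by
        intro k _
        have := hT (T k) (T k - coef k d * z d)
        rw [sub_sub_cancel] at this
        refine this.trans (mul_le_mul_of_nonneg_left ?_ hK)
        rw [mul_pow]
        exact mul_le_mul (coef_sq_le k d) (hzsq d) (sq_nonneg _) (by positivity)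
      refine (Finset.sum_le_sum this).trans (le_of_eq ?_)
      simp
      field_simp
    have h3 : R ^ 2 ≤ (4 * K * C ^ 2) ^ 2 := by
      rw [← sq_abs]; exact pow_le_pow_left₀ (abs_nonneg _) h2 2
    rw [h1, mul_pow]
    refine mul_le_mul_of_nonneg_left ?_ (by positivity)
    have h4 : z d ^ 2 * g d ^ 2 ≤ C ^ 2 * g d ^ 2 :=
      mul_le_mul_of_nonneg_right (hzsq d) (sq_nonneg _)
    nlinarith [sq_nonneg (z d * g d - R)]
  have hgs : ∑ d, g d ^ 2 ≤ 2 * (n * K ^ 2) := by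
    refine (sum_sq_coef_transpose_le fun k => φ' (T k)).trans ?_
    have : ∑ k : Fin n, φ' (T k) ^ 2 ≤ ∑ k : Fin n, K ^ 2 := by
      refine Finset.sum_le_sum fun k _ => ?_
      rw [← sq_abs]; exact pow_le_pow_left₀ (abs_nonneg _) (hφ' _) 2
    simp at this
    linarith
  refine (Finset.sum_le_sum fun d _ => hone d).trans ?_
  rw [← Finset.mul_sum, Finset.sum_add_distrib, ← Finset.mul_sum]
  simp only [Finset.sum_const, Finset.card_univ, Fintype.card_fin, nsmul_eq_mul]
  calc (n : ℝ)⁻¹ ^ 2 * (2 * C ^ 2 * ∑ d, g d ^ 2 + n * (2 * (4 * K * C ^ 2) ^ 2))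
      ≤ (n : ℝ)⁻¹ ^ 2 * (2 * C ^ 2 * (2 * (n * K ^ 2)) + n * (2 * (4 * K * C ^ 2) ^ 2)) := by
        gcongr
    _ = _ := by field_simp; ring

theorem ae_tendsto_zero_of_summable_integral {Ω : Type*} [MeasurableSpace Ω] {P : Measure Ω}
    {f : ℕ → Ω → ℝ} (hf : ∀ n, Measurable (f n)) (hi : ∀ n, Integrable (f n) P)
    (h0 : ∀ n ω, 0 ≤ f n ω) {c : ℕ → ℝ} (hc : Summable c) (hK : ∀ n, ∫ ω, f n ω ∂P ≤ c n) :
    ∀ᵐ ω ∂P, Tendsto (fun n => f n ω) atTop (𝓝 0) := by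
  have hm : ∀ n, Measurable fun ω => ENNReal.ofReal (f n ω) := fun n => (hf n).ennreal_ofReal
  have h1 : ∫⁻ ω, ∑' n, ENNReal.ofReal (f n ω) ∂P ≠ ⊤ := by
    rw [lintegral_tsum fun n => (hm n).aemeasurable]
    refine ne_top_of_le_ne_top hc.tsum_ofReal_ne_top (ENNReal.tsum_le_tsum fun n => ?_)
    rw [← ofReal_integral_eq_lintegral_ofReal (hi n) (ae_of_all _ (h0 n))]
    exact ENNReal.ofReal_le_ofReal (hK n)
  filter_upwards [ae_lt_top (Measurable.tsum hm) h1] with ω hω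
  have h2 := ENNReal.tendsto_atTop_zero_of_tsum_ne_top hω.ne
  refine ((ENNReal.tendsto_toReal ENNReal.zero_ne_top).comp h2).congr fun n => ?_
  simp [ENNReal.toReal_ofReal (h0 n ω)]

theorem ae_tendsto_zero_of_integral_pow_four_le {Ω : Type*} [MeasurableSpace Ω] {P : Measure Ω}
    {X : ℕ → Ω → ℝ} (hX : ∀ n, Measurable (X n)) (hi : ∀ n, Integrable (fun ω => X n ω ^ 4) P)
    {K : ℝ} (hK : ∀ n, ∫ ω, X n ω ^ 4 ∂P ≤ K / (n : ℝ) ^ 2) :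
    ∀ᵐ ω ∂P, Tendsto (fun n => X n ω) atTop (𝓝 0) := by
  have hsum : Summable fun n : ℕ => K / (n : ℝ) ^ 2 := by
    simpa [div_eq_mul_inv] using (Real.summable_nat_pow_inv.2 one_lt_two).mul_left K
  filter_upwards [ae_tendsto_zero_of_summable_integral (fun n => (hX n).pow_const 4) hi
    (fun n ω => by positivity) hsum hK] with ω h3
  have h4 : Tendsto (fun n => |X n ω|) atTop (𝓝 0) := by
    have := (Real.continuous_sqrt.comp Real.continuous_sqrt).tendsto 0
    have := this.comp h3
    simp only [Function.comp_def, Real.sqrt_zero] at this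
    refine this.congr fun n => ?_
    rw [show X n ω ^ 4 = (|X n ω| ^ 2) ^ 2 by rw [sq_abs]; ring, Real.sqrt_sq (by positivity),
      Real.sqrt_sq (abs_nonneg _)]
  exact (tendsto_zero_iff_abs_tendsto_zero _).2 h4

/-- Linear spectral statistics of bounded independent variables concentrate at their means: their
fourth central moments are `O(n⁻²)`, which is summable. -/
theorem ae_tendsto_specMean_sub {Ω : Type*} [MeasurableSpace Ω] {P : Measure Ω}
    [IsProbabilityMeasure P] {y : ℕ → Ω → ℝ} (hm : ∀ i, Measurable (y i)) (hy : iIndepFun y P)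
    {C : ℝ} (hC : ∀ i ω, |y i ω| ≤ C)
    {φ φ' : ℝ → ℝ} {K : ℝ} (hφm : Measurable φ) (hφ : ∀ t, |φ t| ≤ 1) (hφ' : ∀ t, |φ' t| ≤ K)
    (hT : ∀ a b, |φ a - φ b - φ' a * (a - b)| ≤ K * (a - b) ^ 2) :
    ∀ᵐ ω ∂P, Tendsto (fun n : ℕ => specMean φ (fun m : Fin n => y m ω)
      - ∫ ω', specMean φ (fun m : Fin n => y m ω') ∂P) atTop (𝓝 0) := by
  have hpi : ∀ n : ℕ, Measurable fun ω => fun m : Fin n => y m ω :=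
    fun n => measurable_pi_lambda _ fun m => hm m
  have hFm : ∀ n : ℕ, Measurable fun ω => specMean φ (fun m : Fin n => y m ω) :=
    fun n => (measurable_specMean hφm).comp (hpi n)
  have hEb : ∀ n : ℕ, |∫ ω', specMean φ (fun m : Fin n => y m ω') ∂P| ≤ 1 := by
    intro n
    have := norm_integral_le_of_norm_le_const (μ := P) (C := 1)
      (f := fun ω' => specMean φ (fun m : Fin n => y m ω'))
      (ae_of_all _ fun ω => by simpa using abs_specMean_le hφ _)
    simpa using this
  refine ae_tendsto_zero_of_integral_pow_four_le (fun n => (hFm n).sub_const _) (fun n => ?_)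
    (K := 11 * (K ^ 2 * (4 * C ^ 2 + 32 * C ^ 4)) ^ 2) fun n => ?_
  · refine integrable_of_abs_le (((hFm n).sub_const _).pow_const 4) (B := 2 ^ 4) fun ω => ?_
    rw [abs_pow]
    exact pow_le_pow_left₀ (abs_nonneg _) ((abs_sub _ _).trans
      (by linarith [hEb n, abs_specMean_le hφ (fun m : Fin n => y m ω)])) 4
  · have : ∀ i : Fin n, IsProbabilityMeasure (P.map (y i)) :=
      fun i => Measure.isProbabilityMeasure_map (hm i).aemeasurable
    have hlaw := iIndepFun.map_fun_eq_pi_map (f := fun m : Fin n => y m)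
      (fun i => (hm i).aemeasurable) (hy.precomp Fin.val_injective)
    have h4 := fourth_moment_le (0 : ℝ) (fun i : Fin n => P.map (y i))
      (measurable_specMean (n := n) hφm) (abs_specMean_le hφ) {t | |t| ≤ C}
      (fun i => (ae_map_iff (hm i).aemeasurable
        (measurableSet_le measurable_norm measurable_const)).2 (ae_of_all _ fun ω => hC i ω))
      (fun z hz => sum_sq_specMean_update_le hφ' hT z hz)
    rw [← hlaw, integral_map (hpi n).aemeasurable (measurable_specMean hφm).aestronglyMeasurable,
      integral_map (hpi n).aemeasurable
        (((measurable_specMean hφm).sub_const _).pow_const 4).aestronglyMeasurable, div_pow] at h4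
    rw [mul_div_assoc]
    exact h4

/-! ### The central limit theorem for a single point of the spectrum -/

/-- The part of `t` beyond the level `C`. -/
noncomputable def tail (C t : ℝ) : ℝ := if |t| ≤ C then 0 else t

theorem measurable_tail (C : ℝ) : Measurable (tail C) :=
  Measurable.ite (measurableSet_le measurable_norm measurable_const) measurable_const measurable_id

theorem tail_sq_le (C t : ℝ) : tail C t ^ 2 ≤ t ^ 2 := by
  unfold tail
  split_ifs
  · simpa using sq_nonneg t
  · exact le_rfl

theorem integrable_tail_sq {Ω : Type*} [MeasurableSpace Ω] {P : Measure Ω} {X : Ω → ℝ}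
    (hX : Measurable X) (h2 : MemLp X 2 P) (C : ℝ) :
    Integrable (fun ω => tail C (X ω) ^ 2) P := by
  refine h2.integrable_sq.mono' (((measurable_tail C).comp hX).pow_const 2).aestronglyMeasurable
    (ae_of_all _ fun ω => ?_)
  rw [Real.norm_eq_abs, abs_of_nonneg (sq_nonneg _)]
  exact tail_sq_le C _

theorem norm_exp_sub_taylor_le (t : ℝ) :
    ‖Complex.exp (t * Complex.I) - (1 + t * Complex.I - t ^ 2 / 2)‖ ≤ 4 * |t| ^ 3 ∧
    ‖Complex.exp (t * Complex.I) - (1 + t * Complex.I - t ^ 2 / 2)‖ ≤ 4 * t ^ 2 := by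
  have hn : ‖(t * Complex.I : ℂ)‖ = |t| := by simp
  rcases le_total |t| 1 with h | h
  · have h1 := Complex.exp_bound (x := t * Complex.I) (by rw [hn]; exact h) (n := 3) (by norm_num)
    have h2 : ∑ m ∈ Finset.range 3, (t * Complex.I : ℂ) ^ m / (m.factorial : ℂ)
        = 1 + t * Complex.I - t ^ 2 / 2 := by
      simp [Finset.sum_range_succ, Nat.factorial]
      rw [mul_pow, Complex.I_sq]; ring
    rw [h2, hn] at h1
    have h3 : |t| ^ 3 ≤ t ^ 2 := by
      rw [← sq_abs t]
      nlinarith [sq_nonneg |t|]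
    have h4 : 0 ≤ |t| ^ 3 := by positivity
    have h5 : ((Nat.succ 3 : ℕ) * ((3 : ℕ).factorial * (3 : ℕ) : ℝ)⁻¹ : ℝ) ≤ 1 := by
      norm_num [Nat.factorial]
    have h6 : |t| ^ 3 * ((Nat.succ 3 : ℕ) * ((3 : ℕ).factorial * (3 : ℕ) : ℝ)⁻¹ : ℝ) ≤ |t| ^ 3 :=
      mul_le_of_le_one_right h4 h5
    constructor <;> linarith
  · have h1 : ‖Complex.exp (t * Complex.I) - (1 + t * Complex.I - t ^ 2 / 2)‖ ≤
        1 + (1 + |t| + t ^ 2 / 2) := by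
      refine (norm_sub_le _ _).trans ?_
      rw [Complex.norm_exp_ofReal_mul_I]
      gcongr
      refine (norm_sub_le _ _).trans ?_
      refine add_le_add ((norm_add_le _ _).trans (by simp)) ?_
      simp
    have h2 : t ^ 2 = |t| ^ 2 := (sq_abs t).symm
    rw [h2] at h1 ⊢
    constructor <;> nlinarith

/-- The second order Taylor error is of third order below the level `C` and of second order
beyond it. -/
theorem norm_exp_sub_taylor_le_tail (u t : ℝ) {C : ℝ} (hC : 0 ≤ C) :
    ‖Complex.exp ((u * t : ℝ) * Complex.I) - (1 + (u * t : ℝ) * Complex.I - (u * t : ℝ) ^ 2 / 2)‖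
      ≤ 4 * u ^ 2 * (C * |u| * t ^ 2 + tail C t ^ 2) := by
  obtain ⟨h1, h2⟩ := norm_exp_sub_taylor_le (u * t)
  unfold tail
  split_ifs with h
  · refine h1.trans ?_
    have : |u * t| ^ 3 = u ^ 2 * |u| * t ^ 2 * |t| := by
      rw [abs_mul, ← sq_abs u, ← sq_abs t]; ring
    rw [this]
    have h3 : u ^ 2 * |u| * t ^ 2 * |t| ≤ u ^ 2 * |u| * t ^ 2 * C := by gcongr
    nlinarith
  · refine h2.trans ?_
    have : 0 ≤ C * |u| * t ^ 2 := by positivity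
    nlinarith [sq_nonneg u]

/-- The second order expansion of a characteristic function, with an error that depends on the
distribution only through its tails. -/
theorem norm_charFun_sub_le {Ω : Type*} [MeasurableSpace Ω] {P : Measure Ω}
    [IsProbabilityMeasure P] {X : Ω → ℝ} (hX : Measurable X) (h2 : MemLp X 2 P)
    (h0 : ∫ ω, X ω ∂P = 0) (h1 : ∫ ω, X ω ^ 2 ∂P = 1) {C ε : ℝ} (hC : 0 ≤ C)
    (hε : ∫ ω, tail C (X ω) ^ 2 ∂P ≤ ε) (u : ℝ) :
    ‖∫ ω, Complex.exp ((u * X ω : ℝ) * Complex.I) ∂P - (1 - u ^ 2 / 2 : ℝ)‖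
      ≤ 4 * u ^ 2 * (C * |u| + ε) := by
  have i1 : Integrable X P := h2.integrable (by norm_num)
  have i2 : Integrable (fun ω => X ω ^ 2) P := h2.integrable_sq
  have i3 : Integrable (fun ω => tail C (X ω) ^ 2) P := integrable_tail_sq hX h2 C
  have ie : Integrable (fun ω => Complex.exp ((u * X ω : ℝ) * Complex.I)) P := by
    refine Integrable.of_bound (C := 1) ?_ (ae_of_all _ fun ω => by
      rw [Complex.norm_exp_ofReal_mul_I])
    exact (by fun_prop : Measurable fun ω =>
      Complex.exp ((u * X ω : ℝ) * Complex.I)).aestronglyMeasurable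
  have it1 : Integrable (fun ω => ((u * X ω : ℝ) : ℂ) * Complex.I) P :=
    ((i1.const_mul u).ofReal).mul_const _
  have it2 : Integrable (fun ω => ((u * X ω : ℝ) : ℂ) ^ 2 / 2) P := by
    have : Integrable (fun ω => ((u ^ 2 / 2 * X ω ^ 2 : ℝ) : ℂ)) P := (i2.const_mul _).ofReal
    refine this.congr (ae_of_all _ fun ω => ?_)
    push_cast; ring
  have it : Integrable (fun ω => 1 + ((u * X ω : ℝ) : ℂ) * Complex.I -
      ((u * X ω : ℝ) : ℂ) ^ 2 / 2) P := ((integrable_const _).add it1).sub it2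
  have ev : ∫ ω, (1 + ((u * X ω : ℝ) : ℂ) * Complex.I - ((u * X ω : ℝ) : ℂ) ^ 2 / 2) ∂P
      = ((1 - u ^ 2 / 2 : ℝ) : ℂ) := by
    have e1 : ∫ ω, ((u * X ω : ℝ) : ℂ) * Complex.I ∂P = 0 := by
      rw [integral_mul_const, integral_complex_ofReal, integral_const_mul, h0]; simp
    have e2 : ∫ ω, ((u * X ω : ℝ) : ℂ) ^ 2 / 2 ∂P = ((u ^ 2 / 2 : ℝ) : ℂ) := by
      have : (fun ω => ((u * X ω : ℝ) : ℂ) ^ 2 / 2) = fun ω => ((u ^ 2 / 2 * X ω ^ 2 : ℝ) : ℂ) := by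
        ext ω; push_cast; ring
      rw [this, integral_complex_ofReal, integral_const_mul, h1, mul_one]
    have ia : Integrable (fun ω => 1 + ((u * X ω : ℝ) : ℂ) * Complex.I) P :=
      (integrable_const _).add it1
    rw [integral_sub ia it2, integral_add (integrable_const _) it1, e1, e2]
    simp
  rw [← ev, ← integral_sub ie it]
  refine (norm_integral_le_integral_norm _).trans ?_
  have ib : Integrable (fun ω => 4 * u ^ 2 * (C * |u| * X ω ^ 2 + tail C (X ω) ^ 2)) P :=
    ((i2.const_mul _).add i3).const_mul _
  refine (integral_mono (ie.sub it).norm ib fun ω =>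
    norm_exp_sub_taylor_le_tail u (X ω) hC).trans ?_
  rw [integral_const_mul, integral_add (i2.const_mul _) i3, integral_const_mul, h1, mul_one]
  gcongr

theorem abs_exp_neg_sub_le {v : ℝ} (hv : 0 ≤ v) : |Real.exp (-v) - (1 - v)| ≤ v ^ 2 := by
  rcases le_total v 1 with h | h
  · have := Real.abs_exp_sub_one_sub_id_le (x := -v) (by rwa [abs_neg, abs_of_nonneg hv])
    rw [neg_sq] at this
    convert! this using 2
    ring
  · have h1 : Real.exp (-v) ≤ 1 := Real.exp_le_one_iff.2 (by linarith)
    have h2 := Real.add_one_le_exp (-v)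
    rw [abs_le]
    constructor <;> nlinarith

theorem abs_exp_neg_sub_exp_neg_le {a b : ℝ} (ha : 0 ≤ a) (hab : a ≤ b) :
    |Real.exp (-b) - Real.exp (-a)| ≤ b - a := by
  have h1 : Real.exp (-b) ≤ Real.exp (-a) := Real.exp_le_exp.2 (by linarith)
  have h2 : Real.exp (-b) = Real.exp (-a) * Real.exp (-(b - a)) := by
    rw [← Real.exp_add]; ring_nf
  have h3 := Real.add_one_le_exp (-(b - a))
  have h4 : Real.exp (-a) ≤ 1 := Real.exp_le_one_iff.2 (by linarith)
  rw [abs_of_nonpos (by linarith), h2]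
  nlinarith [Real.exp_pos (-a)]

theorem norm_prod_sub_prod_le {ι : Type*} (s : Finset ι) (f g : ι → ℂ) (hf : ∀ i, ‖f i‖ ≤ 1)
    (hg : ∀ i, ‖g i‖ ≤ 1) : ‖∏ i ∈ s, f i - ∏ i ∈ s, g i‖ ≤ ∑ i ∈ s, ‖f i - g i‖ := by
  classical
  induction s using Finset.induction_on with
  | empty => simp
  | insert a s ha ih =>
    rw [Finset.prod_insert ha, Finset.prod_insert ha, Finset.sum_insert ha]
    have h : f a * ∏ i ∈ s, f i - g a * ∏ i ∈ s, g i
        = (f a - g a) * ∏ i ∈ s, f i + g a * (∏ i ∈ s, f i - ∏ i ∈ s, g i) := by ring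
    rw [h]
    refine (norm_add_le _ _).trans (add_le_add ?_ ?_)
    · rw [norm_mul, norm_prod]
      exact mul_le_of_le_one_right (norm_nonneg _)
        (Finset.prod_le_one (fun _ _ => norm_nonneg _) fun i _ => hf i)
    · rw [norm_mul]
      exact (mul_le_of_le_one_left (norm_nonneg _) (hg a)).trans ih

/-- A quantitative form of the central limit theorem for one point of the spectrum. The index with
`2 * k + 1 = n` has to be left out because its point is identically zero. -/
theorem norm_charFun_point_sub_le {Ω : Type*} [MeasurableSpace Ω] {P : Measure Ω}
    [IsProbabilityMeasure P] {x : ℕ → Ω → ℝ} (hx : IsInput P x) {C ε : ℝ} (hC : 0 ≤ C)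
    (hε : ∀ i, ∫ ω, tail C (x i ω) ^ 2 ∂P ≤ ε) (s : ℝ) {n : ℕ} {k : Fin n}
    (hk : 2 * (k : ℕ) + 1 ≠ n) :
    ‖∫ ω, Complex.exp ((s * ∑ m : Fin n, coef k m * x m ω : ℝ) * Complex.I) ∂P
      - Real.exp (-(s ^ 2 / 2))‖
      ≤ s ^ 2 * (4 * (C * (|s| * (2 / Real.sqrt n)) + ε) + s ^ 2 / n + 1 / n) := by
  have hn : 0 < n := k.pos
  have hnr : (0 : ℝ) < n := by exact_mod_cast hn
  have hε0 : 0 ≤ ε := (integral_nonneg fun ω => sq_nonneg _).trans (hε 0)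
  obtain ⟨hc1, hc2⟩ := sum_coef_sq_le_one hk
  set S := ∑ m, coef k m ^ 2 with hS
  set u : Fin n → ℝ := fun m => s * coef k m with hu
  have hind : iIndepFun (fun m : Fin n => x m) P := hx.indep.precomp Fin.val_injective
  have hprod : ∫ ω, Complex.exp ((s * ∑ m : Fin n, coef k m * x m ω : ℝ) * Complex.I) ∂P
      = ∏ m : Fin n, ∫ ω, Complex.exp ((u m * x m ω : ℝ) * Complex.I) ∂P := by
    rw [← hind.integral_fun_prod_comp
      (f := fun (m : Fin n) (t : ℝ) => Complex.exp ((u m * t : ℝ) * Complex.I))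
      (fun m => (hx.measurable m).aemeasurable) (fun m => by
        refine Measurable.aestronglyMeasurable ?_
        fun_prop)]
    congr 1
    ext ω
    rw [← Complex.exp_sum, ← Finset.sum_mul, Finset.mul_sum]
    push_cast
    congr 2
    refine Finset.sum_congr rfl fun m _ => ?_
    simp only [hu]
    push_cast
    ring
  have hexp : (Real.exp (-(s ^ 2 * S / 2)) : ℂ) =
      ∏ m : Fin n, ((Real.exp (-(u m ^ 2 / 2)) : ℝ) : ℂ) := by
    rw [← Complex.ofReal_prod, ← Real.exp_sum, hS, Finset.mul_sum, Finset.sum_div,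
      ← Finset.sum_neg_distrib]
    congr 3
    ext m
    simp only [hu]
    ring
  have hone : ∀ m : Fin n, ‖∫ ω, Complex.exp ((u m * x m ω : ℝ) * Complex.I) ∂P
      - ((Real.exp (-(u m ^ 2 / 2)) : ℝ) : ℂ)‖ ≤
      (s ^ 2 * coef k m ^ 2) * (4 * (C * (|s| * (2 / Real.sqrt n)) + ε) + s ^ 2 / n) := by
    intro m
    have hvar : ∫ ω, x m ω ^ 2 ∂P = 1 := by
      have := hx.variance_one m
      rw [variance_eq_sub (hx.memLp_two m), hx.mean_zero m] at this
      simpa using this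
    have h1 := norm_charFun_sub_le (hx.measurable m) (hx.memLp_two m) (hx.mean_zero m) hvar hC
      (hε m) (u m)
    have h2 := abs_exp_neg_sub_le (show 0 ≤ u m ^ 2 / 2 by positivity)
    have h3 : ‖((1 - u m ^ 2 / 2 : ℝ) : ℂ) - ((Real.exp (-(u m ^ 2 / 2)) : ℝ) : ℂ)‖ ≤
        (u m ^ 2 / 2) ^ 2 := by
      rw [← Complex.ofReal_sub, Complex.norm_real, Real.norm_eq_abs, abs_sub_comm]
      exact h2
    have h4 := norm_sub_le_norm_sub_add_norm_sub
      (∫ ω, Complex.exp ((u m * x m ω : ℝ) * Complex.I) ∂P) ((1 - u m ^ 2 / 2 : ℝ) : ℂ)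
      ((Real.exp (-(u m ^ 2 / 2)) : ℝ) : ℂ)
    have h5 : |u m| ≤ |s| * (2 / Real.sqrt n) := by
      rw [hu, abs_mul]; gcongr; exact abs_coef_le k m
    have h6 : u m ^ 2 = s ^ 2 * coef k m ^ 2 := by simp only [hu]; ring
    have h7 : 4 * u m ^ 2 * (C * |u m| + ε) ≤
        4 * u m ^ 2 * (C * (|s| * (2 / Real.sqrt n)) + ε) := by gcongr
    have h8 : (u m ^ 2 / 2) ^ 2 ≤ u m ^ 2 * (s ^ 2 / n) := by
      have : u m ^ 2 ≤ s ^ 2 * (4 / n) := by rw [h6]; gcongr; exact coef_sq_le k m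
      calc (u m ^ 2 / 2) ^ 2 = u m ^ 2 * u m ^ 2 / 4 := by ring
        _ ≤ u m ^ 2 * (s ^ 2 * (4 / n)) / 4 := by gcongr
        _ = _ := by ring
    rw [← h6]
    linarith
  have hA : ‖∫ ω, Complex.exp ((s * ∑ m : Fin n, coef k m * x m ω : ℝ) * Complex.I) ∂P
      - Real.exp (-(s ^ 2 * S / 2))‖ ≤
      s ^ 2 * (4 * (C * (|s| * (2 / Real.sqrt n)) + ε) + s ^ 2 / n) := by
    rw [hprod, hexp]
    refine (norm_prod_sub_prod_le _ _ _ (fun m => ?_) fun m => ?_).trans ?_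
    · have := norm_integral_le_of_norm_le_const (μ := P) (C := 1)
        (f := fun ω => Complex.exp ((u m * x m ω : ℝ) * Complex.I))
        (ae_of_all _ fun ω => by rw [Complex.norm_exp_ofReal_mul_I])
      simpa using this
    · rw [Complex.norm_real, Real.norm_eq_abs, abs_of_pos (Real.exp_pos _)]
      exact Real.exp_le_one_iff.2 (by have := sq_nonneg (u m); linarith)
    · refine (Finset.sum_le_sum fun m _ => hone m).trans ?_
      rw [← Finset.sum_mul, ← Finset.mul_sum, ← hS]
      refine mul_le_mul_of_nonneg_right ?_ (by positivity)
      exact mul_le_of_le_one_right (sq_nonneg s) hc1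
  have hB : ‖((Real.exp (-(s ^ 2 * S / 2)) : ℝ) : ℂ) - ((Real.exp (-(s ^ 2 / 2)) : ℝ) : ℂ)‖
      ≤ s ^ 2 * (1 / n) := by
    have hS0 : 0 ≤ S := Finset.sum_nonneg fun _ _ => sq_nonneg _
    have := abs_exp_neg_sub_exp_neg_le (a := s ^ 2 * S / 2) (b := s ^ 2 / 2) (by positivity)
      (by nlinarith [sq_nonneg s])
    rw [← Complex.ofReal_sub, Complex.norm_real, Real.norm_eq_abs, abs_sub_comm]
    refine this.trans ?_
    have h1 : s ^ 2 * (1 - S) ≤ s ^ 2 * (1 / n) :=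
      mul_le_mul_of_nonneg_left (by linarith) (sq_nonneg s)
    nlinarith [mul_nonneg (sq_nonneg s) (sub_nonneg.2 hc1)]
  have := norm_sub_le_norm_sub_add_norm_sub
    (∫ ω, Complex.exp ((s * ∑ m : Fin n, coef k m * x m ω : ℝ) * Complex.I) ∂P)
    ((Real.exp (-(s ^ 2 * S / 2)) : ℝ) : ℂ) ((Real.exp (-(s ^ 2 / 2)) : ℝ) : ℂ)
  linarith

/-! ### Control of the tails under (A1), (A2) and (A3) -/

/-- The only consequence of the assumptions (A1), (A2), (A3) that is used besides `IsInput`: for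
every `ε` there is a truncation level beyond which the variables carry at most `ε` of their second
moment, both in the mean and, almost surely, in the empirical mean. -/
def TailControl {Ω : Type*} [MeasurableSpace Ω] (P : Measure Ω) (x : ℕ → Ω → ℝ) : Prop :=
  ∀ ε : ℝ, 0 < ε → ∃ C : ℝ, 0 ≤ C ∧ (∀ i, ∫ ω, tail C (x i ω) ^ 2 ∂P ≤ ε) ∧
    ∀ᵐ ω ∂P, ∀ᶠ n : ℕ in atTop, ∑ m ∈ Finset.range n, tail C (x m ω) ^ 2 ≤ ε * n

section TailControl

variable {Ω : Type*} [MeasurableSpace Ω] {P : Measure Ω} {x : ℕ → Ω → ℝ}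

theorem A2.tailControl (hx : A2 P x) : TailControl P x := by
  obtain ⟨hin, hid⟩ := hx
  intro ε hε
  have hlim : Tendsto (fun C : ℕ => ∫ ω, tail C (x 0 ω) ^ 2 ∂P) atTop (𝓝 0) := by
    rw [show (0 : ℝ) = ∫ ω, (0 : ℝ) ∂P by simp]
    refine tendsto_integral_of_dominated_convergence (fun ω => x 0 ω ^ 2)
      (fun C => (((measurable_tail C).comp (hin.measurable 0)).pow_const 2).aestronglyMeasurable)
      (hin.memLp_two 0).integrable_sq (fun C => ae_of_all _ fun ω => ?_)
      (ae_of_all _ fun ω => ?_)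
    · rw [Real.norm_eq_abs, abs_of_nonneg (sq_nonneg _)]
      exact tail_sq_le _ _
    · obtain ⟨N, hN⟩ := exists_nat_ge |x 0 ω|
      refine tendsto_const_nhds.congr' ?_
      filter_upwards [eventually_ge_atTop N] with C hC
      have : |x 0 ω| ≤ (C : ℝ) := hN.trans (by exact_mod_cast hC)
      simp [tail, this]
  obtain ⟨C, hC⟩ := (hlim.eventually (gt_mem_nhds hε)).exists
  have hm : Measurable fun t => tail C t ^ 2 := (measurable_tail C).pow_const 2
  have hid' : ∀ i, IdentDistrib (fun ω => tail C (x i ω) ^ 2) (fun ω => tail C (x 0 ω) ^ 2) P P :=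
    fun i => (hid i 0).comp hm
  refine ⟨C, Nat.cast_nonneg C, fun i => ?_, ?_⟩
  · rw [(hid' i).integral_eq]; exact hC.le
  · have hslln := strong_law_ae_real (fun i ω => tail C (x i ω) ^ 2)
      (integrable_tail_sq (hin.measurable 0) (hin.memLp_two 0) C)
      (fun i j hij => (hin.indep.indepFun hij).comp hm hm) hid'
    filter_upwards [hslln] with ω hω
    filter_upwards [hω.eventually (gt_mem_nhds hC), eventually_gt_atTop 0] with n hn hn0
    have hnr : (0 : ℝ) < n := by exact_mod_cast hn0
    rw [div_lt_iff₀ hnr] at hn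
    exact hn.le

variable [IsProbabilityMeasure P]

/-- A one-sided law of large numbers up to a constant factor, by Chebyshev's inequality along the
powers of two and monotonicity in between. -/
theorem ae_eventually_sum_le {Y : ℕ → Ω → ℝ} (hm : ∀ i, Measurable (Y i)) (hind : iIndepFun Y P)
    (h0 : ∀ i ω, 0 ≤ Y i ω) (h2 : ∀ i, MemLp (Y i) 2 P) {K L : ℝ}
    (hK : ∀ i, ∫ ω, Y i ω ∂P ≤ K) (hL : ∀ i, ∫ ω, Y i ω ^ 2 ∂P ≤ L) :
    ∀ᵐ ω ∂P, ∀ᶠ n : ℕ in atTop, ∑ i ∈ Finset.range n, Y i ω ≤ 2 * (K + 1) * n := by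
  have hK0 : 0 ≤ K := (integral_nonneg (h0 0)).trans (hK 0)
  set S : ℕ → Ω → ℝ := fun j ω => ∑ i ∈ Finset.range (2 ^ j), Y i ω with hS
  have hSm : ∀ j, Measurable (S j) := fun j => Finset.measurable_sum _ fun i _ => hm i
  have hS2 : ∀ j, MemLp (S j) 2 P := fun j => memLp_finsetSum _ fun i _ => h2 i
  have hES : ∀ j, ∫ ω, S j ω ∂P ≤ 2 ^ j * K := by
    intro j
    simp only [hS]
    rw [integral_finsetSum _ fun i _ => (h2 i).integrable (by norm_num)]
    refine (Finset.sum_le_sum fun i _ => hK i).trans ?_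
    simp
  have hvar : ∀ j, variance (S j) P ≤ 2 ^ j * L := by
    intro j
    have : S j = ∑ i ∈ Finset.range (2 ^ j), Y i := by ext ω; simp [hS]
    rw [this, IndepFun.variance_sum (fun i _ => h2 i) fun i _ k _ hik => hind.indepFun hik]
    have : ∀ i, variance (Y i) P ≤ L := fun i => (variance_le_expectation_sq
      (hm i).aestronglyMeasurable).trans (hL i)
    refine (Finset.sum_le_sum fun i _ => this i).trans ?_
    simp
  set f : ℕ → Ω → ℝ := fun j ω => ((2 : ℝ) ^ j)⁻¹ ^ 2 * (S j ω - ∫ ω', S j ω' ∂P) ^ 2 with hf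
  have hfi : ∀ j, Integrable (f j) P := fun j =>
    (((hS2 j).sub (memLp_const _)).integrable_sq).const_mul _
  have hfe : ∀ j, ∫ ω, f j ω ∂P ≤ L * (1 / 2) ^ j := by
    intro j
    simp only [hf]
    rw [integral_const_mul, ← variance_eq_integral (hSm j).aemeasurable]
    calc _ ≤ ((2 : ℝ) ^ j)⁻¹ ^ 2 * (2 ^ j * L) := by gcongr; exact hvar j
      _ = _ := by rw [div_pow, one_pow]; field_simp
  have hsm : Summable fun j : ℕ => L * (1 / 2 : ℝ) ^ j :=
    (summable_geometric_of_lt_one (by norm_num) (by norm_num)).mul_left L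
  filter_upwards [ae_tendsto_zero_of_summable_integral (f := f)
    (fun j => (((hSm j).sub_const _).pow_const 2).const_mul _) hfi
    (fun j ω => by simp only [hf]; positivity) hsm hfe] with ω hω
  obtain ⟨J, hJ⟩ := eventually_atTop.1 (hω.eventually (gt_mem_nhds one_pos))
  filter_upwards [eventually_ge_atTop (2 ^ J)] with n hn
  have hn0 : n ≠ 0 := (lt_of_lt_of_le (by positivity) hn).ne'
  -- the power of two with `n < 2 ^ j ≤ 2 * n`
  set j := Nat.log 2 n + 1 with hj
  have hjJ : J ≤ j := (Nat.le_log_of_pow_le one_lt_two hn).trans (Nat.le_succ _)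
  have hn1 : n ≤ 2 ^ j := (Nat.lt_pow_succ_log_self one_lt_two n).le
  have hn2 : (2 : ℝ) ^ j ≤ 2 * n := by
    have : 2 ^ Nat.log 2 n ≤ n := Nat.pow_log_le_self 2 hn0
    have h' : 2 ^ j ≤ 2 * n := by rw [hj, pow_succ]; omega
    exact_mod_cast h'
  have h1 := hJ j hjJ
  have h2j : (0 : ℝ) < 2 ^ j := by positivity
  have h3 : S j ω ≤ 2 ^ j * (K + 1) := by
    have hsq : (S j ω - ∫ ω', S j ω' ∂P) ^ 2 < (2 ^ j) ^ 2 := by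
      simp only [hf] at h1
      rw [inv_pow, inv_mul_lt_iff₀ (by positivity)] at h1
      linarith
    have := abs_lt_of_sq_lt_sq hsq h2j.le
    have := (abs_lt.1 this).2
    linarith [hES j]
  calc ∑ i ∈ Finset.range n, Y i ω ≤ ∑ i ∈ Finset.range (2 ^ j), Y i ω :=
        Finset.sum_le_sum_of_subset_of_nonneg (Finset.range_mono hn1) fun i _ _ => h0 i ω
    _ ≤ 2 ^ j * (K + 1) := h3
    _ ≤ 2 * n * (K + 1) := by gcongr
    _ = _ := by ring

theorem A3.tailControl (hx : A3 P x) : TailControl P x := by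
  obtain ⟨hin, hmom⟩ := hx
  obtain ⟨K, hK⟩ := hmom 4
  obtain ⟨L, hL⟩ := hmom 8
  have e4 : ∀ t : ℝ, |t| ^ 4 = t ^ 4 := fun t => by
    rw [show |t| ^ 4 = (|t| ^ 2) ^ 2 by ring, sq_abs]; ring
  have e8 : ∀ t : ℝ, |t| ^ 8 = (t ^ 4) ^ 2 := fun t => by
    rw [show |t| ^ 8 = (|t| ^ 2) ^ 4 by ring, sq_abs]; ring
  simp only [e4] at hK
  simp only [e8] at hL
  have hK0 : 0 ≤ K := (integral_nonneg fun ω => by positivity).trans (hK 0).2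
  have hm4 : Measurable fun t : ℝ => t ^ 4 := measurable_id.pow_const 4
  have hbound := ae_eventually_sum_le (Y := fun i ω => x i ω ^ 4)
    (fun i => (hin.measurable i).pow_const 4) (hin.indep.comp _ fun _ => hm4)
    (fun i ω => by positivity)
    (fun i => (memLp_two_iff_integrable_sq
      ((hin.measurable i).pow_const 4).aestronglyMeasurable).2 (hL i).1)
    (fun i => (hK i).2) fun i => (hL i).2
  intro ε hε
  -- with this level, `tail C t ^ 2 ≤ t ^ 4 / C ^ 2` turns the bound `2 * (K + 1) * n` on the sums
  -- of fourth powers into `ε * n`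
  set C := Real.sqrt (2 * (K + 1) / ε) with hCdef
  have hCsq : C ^ 2 = 2 * (K + 1) / ε := Real.sq_sqrt (by positivity)
  have htail : ∀ t, tail C t ^ 2 ≤ ε / (2 * (K + 1)) * t ^ 4 := by
    intro t
    unfold tail
    split_ifs with h
    · rw [zero_pow two_ne_zero]; positivity
    · have h1 : C ^ 2 ≤ t ^ 2 := by
        rw [← sq_abs t]
        exact pow_le_pow_left₀ (Real.sqrt_nonneg _) (not_le.1 h).le 2
      have h2 : ε / (2 * (K + 1)) * C ^ 2 = 1 := by rw [hCsq]; field_simp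
      calc t ^ 2 = ε / (2 * (K + 1)) * C ^ 2 * t ^ 2 := by rw [h2, one_mul]
        _ ≤ ε / (2 * (K + 1)) * t ^ 2 * t ^ 2 := by gcongr
        _ = _ := by ring
  refine ⟨C, Real.sqrt_nonneg _, fun i => ?_, ?_⟩
  · calc _ ≤ ∫ ω, ε / (2 * (K + 1)) * x i ω ^ 4 ∂P :=
          integral_mono (integrable_tail_sq (hin.measurable i) (hin.memLp_two i) C)
            ((hK i).1.const_mul _) fun ω => htail _
      _ ≤ ε / (2 * (K + 1)) * K := by
          rw [integral_const_mul]; gcongr; exact (hK i).2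
      _ ≤ ε := by
          rw [div_mul_eq_mul_div, div_le_iff₀ (by positivity)]
          nlinarith
  · filter_upwards [hbound] with ω hω
    filter_upwards [hω] with n hn
    calc _ ≤ ∑ m ∈ Finset.range n, ε / (2 * (K + 1)) * x m ω ^ 4 :=
          Finset.sum_le_sum fun m _ => htail _
      _ = ε / (2 * (K + 1)) * ∑ m ∈ Finset.range n, x m ω ^ 4 := by rw [Finset.mul_sum]
      _ ≤ ε / (2 * (K + 1)) * (2 * (K + 1) * n) := by gcongr
      _ = ε * n := by field_simp

theorem A1.a3 (hx : A1 P x) : A3 P x := by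
  obtain ⟨hin, C, hC⟩ := hx
  refine ⟨hin, fun k => ⟨C ^ k, fun i => ?_⟩⟩
  have hb : ∀ᵐ ω ∂P, |x i ω| ^ k ≤ C ^ k := by
    filter_upwards [hC i] with ω hω
    exact pow_le_pow_left₀ (abs_nonneg _) hω k
  have hint : Integrable (fun ω => |x i ω| ^ k) P := by
    refine Integrable.of_bound (C := C ^ k)
      ((hin.measurable i).abs.pow_const k).aestronglyMeasurable ?_
    filter_upwards [hb] with ω hω
    rwa [Real.norm_eq_abs, abs_of_nonneg (by positivity)]
  refine ⟨hint, ?_⟩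
  calc _ ≤ ∫ ω, C ^ k ∂P := integral_mono_ae hint (integrable_const _) hb
    _ = C ^ k := by simp

end TailControl

/-! ### The spectrum of the negacyclic matrix -/

/-- The eigenvalues can be read off from any invertible matrix of eigenvectors. -/
theorem eigs_eq_of_mul_eq {n : ℕ} {A : Matrix (Fin n) (Fin n) ℝ} {U : Matrix (Fin n) (Fin n) ℂ}
    {v : Fin n → ℂ} (hU : IsUnit U.det)
    (h : A.map (fun t : ℝ => (t : ℂ)) * U = U * Matrix.diagonal v) :
    eigs A = Finset.univ.val.map v := by
  have h1 : A.map (fun t : ℝ => (t : ℂ)) = U * Matrix.diagonal v * U⁻¹ := by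
    rw [← h, Matrix.mul_assoc, Matrix.mul_nonsing_inv _ hU, Matrix.mul_one]
  unfold eigs
  rw [h1, Matrix.charpoly_mul_comm, ← Matrix.mul_assoc, Matrix.nonsing_inv_mul _ hU, Matrix.one_mul,
    Matrix.charpoly_diagonal]
  exact Polynomial.roots_multiset_prod_X_sub_C (Finset.univ.val.map v) ▸ by
    rw [Multiset.map_map]; rfl

theorem skew_patterned_apply {n : ℕ} (L : Fin n → Fin n → ℕ) (a : ℕ → ℝ) (i j : Fin n) :
    skew (patterned L a) i j = if i = j then 0 else if j < i then -a (L i j) else a (L i j) := by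
  simp only [skew, patterned, signMatrix, Matrix.hadamard_apply, Matrix.of_apply]
  split_ifs <;> simp

/-- The negacyclic structure of the skew-symmetric circulant pattern: a vector
`(ζ ^ j)_j` with `ζ ^ n = -1` is an eigenvector. -/
theorem sum_skew_linkSC_mul_pow {n : ℕ} (a : ℕ → ℝ) {ζ : ℂ} (hζ : ζ ^ n = -1) (i : Fin n) :
    ∑ j : Fin n, (skew (patterned (linkSC n) a) i j : ℂ) * ζ ^ (j : ℕ) =
      ζ ^ (i : ℕ) * ∑ d ∈ Finset.range n,
        ((if d = 0 then 0 else a (min d (n - d)) : ℝ) : ℂ) * ζ ^ d := by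
  have hi := i.isLt
  rw [Finset.sum_range, Finset.mul_sum]
  refine Finset.sum_nbij' (fun j => ⟨if i ≤ j then (j : ℕ) - i else j + n - i, ?_⟩)
    (fun d => ⟨if (d : ℕ) + i < n then (d : ℕ) + i else d + i - n, ?_⟩)
    (fun _ _ => Finset.mem_univ _) (fun _ _ => Finset.mem_univ _) ?_ ?_ ?_
  · have := j.isLt; split_ifs with h
    · omega
    · rw [Fin.le_def] at h; omega
  · have := d.isLt; split_ifs <;> omega
  · intro j _
    have := j.isLt
    ext
    simp only [Fin.le_def]
    split_ifs <;> omega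
  · intro j _
    have := j.isLt
    ext
    simp only [Fin.le_def]
    split_ifs <;> omega
  · intro j _
    have hj := j.isLt
    rw [skew_patterned_apply]
    simp only [linkSC, gap]
    rcases lt_trichotomy i j with h | h | h
    · rw [Fin.lt_def] at h
      have h1 : ((i : ℤ) - (j : ℤ)).natAbs = (j : ℕ) - i := by omega
      have h2 : (if i ≤ j then (j : ℕ) - i else j + n - i) = j - i :=
        if_pos (by rw [Fin.le_def]; omega)
      simp only [h2]
      rw [if_neg (by rw [Fin.ext_iff]; omega), if_neg (by rw [Fin.lt_def]; omega),
        if_neg (by omega), h1, mul_left_comm, ← pow_add, show (i : ℕ) + (j - i) = j by omega]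
    · subst h; simp
    · rw [Fin.lt_def] at h
      have h1 : ((i : ℤ) - (j : ℤ)).natAbs = (i : ℕ) - j := by omega
      have h2 : (if i ≤ j then (j : ℕ) - i else j + n - i) = j + n - i :=
        if_neg (by rw [Fin.le_def]; omega)
      simp only [h2]
      rw [if_neg (by rw [Fin.ext_iff]; omega), if_pos (by rw [Fin.lt_def]; omega),
        if_neg (by omega), h1, mul_left_comm, ← pow_add,
        show (i : ℕ) + (j + n - i) = j + n by omega, pow_add, hζ, min_comm,
        show n - ((i : ℕ) - j) = j + n - i by omega, show n - ((j : ℕ) + n - i) = i - j by omega]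
      push_cast
      ring

theorem exp_angle_pow {n : ℕ} (hn : 0 < n) (k : ℕ) :
    Complex.exp (angle n k * Complex.I) ^ n = -1 := by
  have hnc : (n : ℂ) ≠ 0 := by exact_mod_cast hn.ne'
  rw [← Complex.exp_nat_mul]
  have : (n : ℂ) * (angle n k * Complex.I) =
      Real.pi * Complex.I + k * (2 * Real.pi * Complex.I) := by
    unfold angle
    push_cast
    field_simp
    ring
  rw [this, Complex.exp_add, Complex.exp_pi_mul_I, Complex.exp_nat_mul_two_pi_mul_I, mul_one]

theorem exp_angle_injective (n : ℕ) :
    Function.Injective fun k : Fin n => Complex.exp (angle n k * Complex.I) := by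
  intro k l h
  have hn := k.pos
  have hnc : (n : ℂ) ≠ 0 := by exact_mod_cast hn.ne'
  obtain ⟨m, hm⟩ := Complex.exp_eq_exp_iff_exists_int.1 h
  have hpi : (Real.pi : ℂ) ≠ 0 := by exact_mod_cast Real.pi_ne_zero
  have hI := Complex.I_ne_zero
  have h1 : ((k : ℕ) : ℂ) = (l : ℕ) + m * n := by
    unfold angle at hm
    push_cast at hm
    field_simp at hm
    linear_combination hm / 2
  have h2 : ((k : ℕ) : ℤ) = (l : ℕ) + m * n := by exact_mod_cast h1
  have hk := k.isLt
  have hl := l.isLt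
  have h3 : ((k : ℕ) : ℤ) - (l : ℕ) = 0 :=
    Int.eq_zero_of_abs_lt_dvd (m := n) ⟨m, by rw [h2]; ring⟩ (by rw [abs_lt]; omega)
  ext
  omega

theorem skewESD_scaledSkewSC (a : ℕ → ℝ) (n : ℕ) (t : ℝ) :
    skewESD (scaledSkewSC a n) t =
      ((Finset.univ.filter fun k : Fin n => ∑ m : Fin n, coef k m * a m ≤ t).card : ℝ) / n := by
  set ζ : Fin n → ℂ := fun k => Complex.exp (angle n k * Complex.I) with hζ
  set u : ℕ → ℝ := fun d => if d = 0 then 0 else a (min d (n - d)) with hu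
  set v : Fin n → ℂ := fun k => ((Real.sqrt n)⁻¹ : ℝ) * ∑ d ∈ Finset.range n, (u d : ℂ) * ζ k ^ d
    with hv
  have hdet : IsUnit (Matrix.vandermonde ζ)ᵀ.det := by
    rw [Matrix.det_transpose, isUnit_iff_ne_zero]
    exact Matrix.det_vandermonde_ne_zero_iff.2 (exp_angle_injective n)
  have hmul : (scaledSkewSC a n).map (fun t : ℝ => (t : ℂ)) * (Matrix.vandermonde ζ)ᵀ
      = (Matrix.vandermonde ζ)ᵀ * Matrix.diagonal v := by
    ext i k
    rw [Matrix.mul_diagonal, Matrix.mul_apply]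
    simp only [Matrix.map_apply, Matrix.transpose_apply, Matrix.vandermonde_apply, scaledSkewSC,
      Matrix.smul_apply, smul_eq_mul, Complex.ofReal_mul, mul_assoc]
    rw [← Finset.mul_sum, sum_skew_linkSC_mul_pow a (exp_angle_pow i.pos k) i]
    simp only [hv, hu, hζ]
    ring
  have hre : ∀ k, (Complex.I * v k).re = ∑ m : Fin n, coef k m * a m := by
    intro k
    rw [sum_coef_mul]
    have : Complex.I * v k = ((Real.sqrt n)⁻¹ : ℝ) * ∑ d ∈ Finset.range n,
        (u d : ℂ) * (Complex.I * Complex.exp ((angle n k * d : ℝ) * Complex.I)) := by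
      simp only [hv, hζ]
      rw [mul_left_comm, Finset.mul_sum]
      congr 1
      refine Finset.sum_congr rfl fun d _ => ?_
      rw [← Complex.exp_nat_mul]
      push_cast
      rw [show (d : ℂ) * (angle n k * Complex.I) = angle n k * d * Complex.I by ring]
      ring
    rw [this, Complex.re_ofReal_mul, Complex.re_sum, neg_mul, ← mul_neg, ← Finset.sum_neg_distrib]
    congr 1
    refine Finset.sum_congr rfl fun d _ => ?_
    rw [Complex.re_ofReal_mul, Complex.I_mul_re, Complex.exp_ofReal_mul_I_im]
    simp [hu]
  unfold skewESD
  rw [eigs_eq_of_mul_eq hdet hmul, Multiset.countP_map]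
  simp only [hre]
  rfl

/-! ### Interlacing and the palindromic Toeplitz matrix -/

/-- Two diagonalised quadratic forms agree along a linear isometry `ι`. If every eigenvalue of the
first one in `S` is smaller than every eigenvalue of the second one outside `R`, then `S` has at
most as many elements as `R`: otherwise some nonzero `v` would have no component outside `S` and
its image none in `R`. -/
theorem card_le_card_of_quadraticForm {p r : ℕ} {E F : Type*} [NormedAddCommGroup E]
    [InnerProductSpace ℂ E] [NormedAddCommGroup F] [InnerProductSpace ℂ F]
    (b : OrthonormalBasis (Fin p) ℂ E) (c : OrthonormalBasis (Fin r) ℂ F)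
    (lam : Fin p → ℝ) (mu : Fin r → ℝ) (ι : E →ₗ[ℂ] F) (hι : ∀ v, ‖ι v‖ = ‖v‖)
    (hq : ∀ v, ∑ k, lam k * ‖inner ℂ (b k) v‖ ^ 2 = ∑ k, mu k * ‖inner ℂ (c k) (ι v)‖ ^ 2)
    (S : Finset (Fin p)) (R : Finset (Fin r)) (hSR : ∀ k ∈ S, ∀ l ∉ R, lam k < mu l) :
    S.card ≤ R.card := by
  by_contra! hlt
  let f : E →ₗ[ℂ] ({k // k ∉ S} → ℂ) × ({l // l ∈ R} → ℂ) :=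
    (LinearMap.pi fun k => innerₛₗ ℂ (b k.1)).prod
      ((LinearMap.pi fun l => innerₛₗ ℂ (c l.1)).comp ι)
  have hfin : FiniteDimensional ℂ E := b.toBasis.finiteDimensional_of_finite
  have hE : Module.finrank ℂ E = p := by
    rw [Module.finrank_eq_card_basis b.toBasis, Fintype.card_fin]
  have hSp : S.card ≤ p := by simpa using S.card_le_univ
  -- the target of `f` has dimension `p - #S + #R < p`
  have hker : LinearMap.ker f ≠ ⊥ := by
    refine LinearMap.ker_ne_bot_of_finrank_lt ?_
    rw [hE, Module.finrank_prod, Module.finrank_fintype_fun_eq_card,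
      Module.finrank_fintype_fun_eq_card, Fintype.card_subtype_compl, Fintype.card_coe,
      Fintype.card_fin]
    simp only [Fintype.card_coe]
    omega
  obtain ⟨v, hv, hv0⟩ := (Submodule.ne_bot_iff _).1 hker
  have hfv : f v = 0 := hv
  have h1 : ∀ k ∉ S, inner ℂ (b k) v = 0 := fun k hk => congrFun (congrArg Prod.fst hfv) ⟨k, hk⟩
  have h2 : ∀ l ∈ R, inner ℂ (c l) (ι v) = 0 := fun l hl =>
    congrFun (congrArg Prod.snd hfv) ⟨l, hl⟩
  set α : Fin p → ℝ := fun k => ‖inner ℂ (b k) v‖ ^ 2 with hα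
  set β : Fin r → ℝ := fun l => ‖inner ℂ (c l) (ι v)‖ ^ 2 with hβ
  have hα0 : ∀ k, 0 ≤ α k := fun k => sq_nonneg _
  have hβ0 : ∀ k, 0 ≤ β k := fun k => sq_nonneg _
  have hN : 0 < ‖v‖ ^ 2 := by positivity
  have hαs : ∑ k, α k = ‖v‖ ^ 2 := b.sum_sq_norm_inner_right v
  have hβs : ∑ l, β l = ‖v‖ ^ 2 := by rw [← hι v]; exact c.sum_sq_norm_inner_right (ι v)
  -- the form values `∑ lam α` and `∑ mu β` agree, and so do the masses `∑ α` and `∑ β`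
  have hzero : ∑ k, ∑ l, α k * β l * (mu l - lam k) = 0 := by
    have : ∑ k, ∑ l, α k * β l * (mu l - lam k) =
        (∑ k, α k) * (∑ l, mu l * β l) - (∑ k, lam k * α k) * ∑ l, β l := by
      rw [Finset.sum_mul_sum, Finset.sum_mul_sum, ← Finset.sum_sub_distrib]
      refine Finset.sum_congr rfl fun k _ => ?_
      rw [← Finset.sum_sub_distrib]
      exact Finset.sum_congr rfl fun l _ => by ring
    rw [this, hαs, hβs, hq v]
    ring
  have hterm : ∀ k l, 0 ≤ α k * β l * (mu l - lam k) := by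
    intro k l
    by_cases hk : k ∈ S
    · by_cases hl : l ∈ R
      · simp [hβ, h2 l hl]
      · exact mul_nonneg (mul_nonneg (hα0 k) (hβ0 l)) (sub_nonneg.2 (hSR k hk l hl).le)
    · simp [hα, h1 k hk]
  obtain ⟨k, -, hk⟩ := Finset.exists_ne_zero_of_sum_ne_zero (hαs ▸ hN.ne' : ∑ k, α k ≠ 0)
  obtain ⟨l, -, hl⟩ := Finset.exists_ne_zero_of_sum_ne_zero (hβs ▸ hN.ne' : ∑ l, β l ≠ 0)
  have hkS : k ∈ S := by
    by_contra h; exact hk (by simp [hα, h1 k h])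
  have hlR : l ∉ R := fun h => hl (by simp [hβ, h2 l h])
  have hz := (Finset.sum_eq_zero_iff_of_nonneg fun k _ => Finset.sum_nonneg fun l _ =>
    hterm k l).1 hzero k (Finset.mem_univ _)
  have hz' := (Finset.sum_eq_zero_iff_of_nonneg fun l _ => hterm k l).1 hz l (Finset.mem_univ _)
  exact (mul_ne_zero (mul_ne_zero hk hl) (sub_pos.2 (hSR k hkS l hlR)).ne') hz'

/-- The Hermitian matrix `i A`. -/
noncomputable def rotate {n : ℕ} (A : Matrix (Fin n) (Fin n) ℝ) : Matrix (Fin n) (Fin n) ℂ :=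
  Complex.I • A.map (fun t : ℝ => (t : ℂ))

theorem isHermitian_rotate {n : ℕ} {A : Matrix (Fin n) (Fin n) ℝ} (hA : ∀ i j, A j i = -A i j) :
    (rotate A).IsHermitian := by
  ext i j
  simp [rotate, hA j i]

theorem eigs_eq_rotate {n : ℕ} {A : Matrix (Fin n) (Fin n) ℝ} (hH : (rotate A).IsHermitian) :
    eigs A = Finset.univ.val.map fun k => -Complex.I * (hH.eigenvalues k : ℂ) := by
  set U : Matrix (Fin n) (Fin n) ℂ := (hH.eigenvectorUnitary).1 with hU
  have hUU : star U * U = 1 := Unitary.coe_star_mul_self hH.eigenvectorUnitary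
  have hdet : IsUnit U.det := by
    refine (Matrix.isUnit_iff_isUnit_det U).1 ?_
    exact IsUnit.of_mul_eq_one_right _ hUU
  refine eigs_eq_of_mul_eq hdet ?_
  have hs := hH.spectral_theorem
  rw [Unitary.conjStarAlgAut_apply] at hs
  have hA : A.map (fun t : ℝ => (t : ℂ)) = -Complex.I • rotate A := by
    rw [rotate, smul_smul]; simp
  rw [hA, Matrix.smul_mul]
  have h2 : rotate A * U = U * Matrix.diagonal (RCLike.ofReal ∘ hH.eigenvalues) := by
    conv_lhs => rw [hs]
    rw [Matrix.mul_assoc, hUU, Matrix.mul_one]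
  rw [h2, ← Matrix.mul_smul]
  congr 1
  ext i j
  simp [Matrix.diagonal_apply]

theorem countP_eigs {n : ℕ} {A : Matrix (Fin n) (Fin n) ℝ} (hH : (rotate A).IsHermitian) (t : ℝ) :
    (eigs A).countP (fun l => (Complex.I * l).re ≤ t) =
      (Finset.univ.filter fun k => hH.eigenvalues k ≤ t).card := by
  rw [eigs_eq_rotate hH, Multiset.countP_map]
  have : ∀ k, (Complex.I * (-Complex.I * (hH.eigenvalues k : ℂ))).re = hH.eigenvalues k := by
    intro k
    rw [← mul_assoc]
    simp
  simp only [this]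
  rfl

/-- The quadratic form of a Hermitian matrix in the coordinates of its eigenbasis. -/
theorem inner_toEuclideanLin_eq {n : ℕ} {H : Matrix (Fin n) (Fin n) ℂ} (hH : H.IsHermitian)
    (v : EuclideanSpace ℂ (Fin n)) : inner ℂ v (Matrix.toEuclideanLin H v) =
      ((∑ k, hH.eigenvalues k * ‖inner ℂ (hH.eigenvectorBasis k) v‖ ^ 2 : ℝ) : ℂ) := by
  rw [← hH.eigenvectorBasis.sum_inner_mul_inner]
  push_cast
  refine Finset.sum_congr rfl fun k _ => ?_
  have hsym := Matrix.isSymmetric_toEuclideanLin_iff.mpr hH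
  have hb : Matrix.toEuclideanLin H (hH.eigenvectorBasis k) =
      (hH.eigenvalues k : ℂ) • hH.eigenvectorBasis k := by
    ext i
    have := congrFun (hH.mulVec_eigenvectorBasis k) i
    simpa using this
  rw [← hsym, hb, inner_smul_left, Complex.conj_ofReal, mul_left_comm,
    ← inner_conj_symm v, Complex.conj_mul']

/-- Extension of vectors by a last coordinate zero. -/
noncomputable def extendZero (n : ℕ) :
    EuclideanSpace ℂ (Fin n) →ₗ[ℂ] EuclideanSpace ℂ (Fin (n + 1)) where
  toFun v := WithLp.toLp 2 (Fin.snoc (α := fun _ => ℂ) (fun i => v i) 0)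
  map_add' v w := by
    ext i
    refine Fin.lastCases ?_ (fun j => ?_) i <;> simp
  map_smul' c v := by
    ext i
    refine Fin.lastCases ?_ (fun j => ?_) i <;> simp

theorem extendZero_castSucc {n : ℕ} (v : EuclideanSpace ℂ (Fin n)) (i : Fin n) :
    extendZero n v i.castSucc = v i := by
  simp [extendZero]

theorem extendZero_last {n : ℕ} (v : EuclideanSpace ℂ (Fin n)) :
    extendZero n v (Fin.last n) = 0 := by
  simp [extendZero]

theorem norm_extendZero {n : ℕ} (v : EuclideanSpace ℂ (Fin n)) : ‖extendZero n v‖ = ‖v‖ := by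
  rw [EuclideanSpace.norm_eq, EuclideanSpace.norm_eq, Fin.sum_univ_castSucc]
  simp [extendZero_castSucc, extendZero_last]

theorem inner_extendZero {n : ℕ} (H : Matrix (Fin (n + 1)) (Fin (n + 1)) ℂ)
    (v : EuclideanSpace ℂ (Fin n)) :
    inner ℂ (extendZero n v) (Matrix.toEuclideanLin H (extendZero n v)) =
      inner ℂ v (Matrix.toEuclideanLin (H.submatrix Fin.castSucc Fin.castSucc) v) := by
  simp only [PiLp.inner_apply, Fin.sum_univ_castSucc, extendZero_castSucc, extendZero_last,
    Matrix.ofLp_toLpLin, Matrix.toLin'_apply, Matrix.mulVec, dotProduct, Matrix.submatrix_apply]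
  simp

/-- Cauchy interlacing for the counting functions of the spectra of a skew-symmetric matrix and of
its leading principal submatrix of corank one. -/
theorem countP_eigs_submatrix {n : ℕ} {A : Matrix (Fin (n + 1)) (Fin (n + 1)) ℝ}
    (hA : ∀ i j, A j i = -A i j) (t : ℝ) :
    (eigs (A.submatrix Fin.castSucc Fin.castSucc)).countP (fun l => (Complex.I * l).re ≤ t) ≤
        (eigs A).countP (fun l => (Complex.I * l).re ≤ t) ∧
      (eigs A).countP (fun l => (Complex.I * l).re ≤ t) ≤
        (eigs (A.submatrix Fin.castSucc Fin.castSucc)).countP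
          (fun l => (Complex.I * l).re ≤ t) + 1 := by
  set B := A.submatrix Fin.castSucc Fin.castSucc with hB
  have hHA : (rotate A).IsHermitian := isHermitian_rotate hA
  have hHB : (rotate B).IsHermitian := isHermitian_rotate fun i j => hA _ _
  have hsub : rotate B = (rotate A).submatrix Fin.castSucc Fin.castSucc := rfl
  have hq : ∀ v, ∑ k, hHB.eigenvalues k * ‖inner ℂ (hHB.eigenvectorBasis k) v‖ ^ 2 =
      ∑ k, hHA.eigenvalues k * ‖inner ℂ (hHA.eigenvectorBasis k) (extendZero n v)‖ ^ 2 := by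
    intro v
    have h1 := inner_toEuclideanLin_eq hHB v
    have h2 := inner_toEuclideanLin_eq hHA (extendZero n v)
    rw [inner_extendZero, ← hsub, h1] at h2
    exact_mod_cast h2
  rw [countP_eigs hHA, countP_eigs hHB]
  have h1 := card_le_card_of_quadraticForm hHB.eigenvectorBasis hHA.eigenvectorBasis
    hHB.eigenvalues hHA.eigenvalues (extendZero n) norm_extendZero hq
    (Finset.univ.filter fun k => hHB.eigenvalues k ≤ t)
    (Finset.univ.filter fun k => hHA.eigenvalues k ≤ t) (by
      intro k hk l hl
      simp only [Finset.mem_filter, Finset.mem_univ, true_and, not_le] at hk hl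
      linarith)
  -- the negated forms compare the numbers of eigenvalues above `t`
  have h2 := card_le_card_of_quadraticForm hHB.eigenvectorBasis hHA.eigenvectorBasis
    (fun k => -hHB.eigenvalues k) (fun k => -hHA.eigenvalues k) (extendZero n) norm_extendZero
    (fun v => by simpa using hq v)
    (Finset.univ.filter fun k => ¬ hHB.eigenvalues k ≤ t)
    (Finset.univ.filter fun k => ¬ hHA.eigenvalues k ≤ t) (by
      intro k hk l hl
      simp only [Finset.mem_filter, Finset.mem_univ, true_and, not_not] at hk hl
      linarith)
  have h3 := Finset.card_filter_add_card_filter_not (s := Finset.univ)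
    (fun k => hHB.eigenvalues k ≤ t)
  have h4 := Finset.card_filter_add_card_filter_not (s := Finset.univ)
    (fun k => hHA.eigenvalues k ≤ t)
  rw [Finset.card_univ, Fintype.card_fin] at h3 h4
  omega

theorem skew_patterned_neg {n : ℕ} {L : Fin n → Fin n → ℕ} (hL : ∀ i j, L i j = L j i)
    (a : ℕ → ℝ) (i j : Fin n) : skew (patterned L a) j i = -skew (patterned L a) i j := by
  rw [skew_patterned_apply, skew_patterned_apply, hL j i]
  rcases lt_trichotomy i j with h | h | h
  · rw [if_neg h.ne', if_pos h, if_neg h.ne, if_neg h.asymm]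
  · simp [h]
  · rw [if_neg h.ne, if_neg h.asymm, if_neg h.ne', if_pos h, neg_neg]

theorem gap_comm {n : ℕ} (i j : Fin n) : gap i j = gap j i := by
  unfold gap; omega

/-- The leading principal submatrix of the palindromic Toeplitz pattern of size `n + 1` is the
symmetric circulant pattern of size `n`. -/
theorem scaledSkewPT_submatrix (a : ℕ → ℝ) {n : ℕ} (hn : 0 < n) :
    (scaledSkewPT a (n + 1)).submatrix Fin.castSucc Fin.castSucc =
      scaledSkewSC (fun m => Real.sqrt n / Real.sqrt (n + 1) * a m) n := by
  have hn' : Real.sqrt n ≠ 0 := (Real.sqrt_pos.2 (by exact_mod_cast hn)).ne'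
  ext i j
  simp only [scaledSkewPT, scaledSkewSC, Matrix.submatrix_apply, Matrix.smul_apply, smul_eq_mul,
    skew_patterned_apply, Fin.castSucc_inj, Fin.castSucc_lt_castSucc_iff]
  have : linkPT (n + 1) i.castSucc j.castSucc = linkSC n i j := by
    simp [linkPT, linkSC, gap]
  rw [this]
  push_cast
  split_ifs
  · simp
  · field_simp
  · field_simp

theorem abs_skewESD_scaledSkewPT_sub_le (a : ℕ → ℝ) {n : ℕ} (hn : 0 < n) (t : ℝ) :
    |skewESD (scaledSkewPT a (n + 1)) t - n / (n + 1) *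
      skewESD (scaledSkewSC a n) (t * (Real.sqrt (n + 1) / Real.sqrt n))| ≤ 1 / (n + 1) := by
  have hnr : (0 : ℝ) < n := by exact_mod_cast hn
  have hs : 0 < Real.sqrt n := Real.sqrt_pos.2 hnr
  have hs1 : 0 < Real.sqrt (n + 1) := Real.sqrt_pos.2 (by positivity)
  have hskew : ∀ i j, scaledSkewPT a (n + 1) j i = -scaledSkewPT a (n + 1) i j := by
    intro i j
    simp only [scaledSkewPT, Matrix.smul_apply, smul_eq_mul]
    rw [skew_patterned_neg fun i j => by simp only [linkPT, gap_comm i j], mul_neg]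
  obtain ⟨h1, h2⟩ := countP_eigs_submatrix hskew t
  have hcount : skewESD (scaledSkewSC a n) (t * (Real.sqrt (n + 1) / Real.sqrt n)) =
      skewESD ((scaledSkewPT a (n + 1)).submatrix Fin.castSucc Fin.castSucc) t := by
    rw [scaledSkewPT_submatrix a hn, skewESD_scaledSkewSC, skewESD_scaledSkewSC]
    congr 3
    ext k
    have : ∑ m : Fin n, coef k m * (Real.sqrt n / Real.sqrt (n + 1) * a m) =
        (∑ m : Fin n, coef k m * a m) / (Real.sqrt (n + 1) / Real.sqrt n) := by
      rw [Finset.sum_div]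
      refine Finset.sum_congr rfl fun m _ => ?_
      field_simp
    simp only [Finset.mem_filter, Finset.mem_univ, true_and]
    rw [this, div_le_iff₀ (by positivity)]
  rw [hcount]
  unfold skewESD
  set p := (eigs (scaledSkewPT a (n + 1))).countP fun l => (Complex.I * l).re ≤ t
  set q := (eigs ((scaledSkewPT a (n + 1)).submatrix Fin.castSucc Fin.castSucc)).countP
    fun l => (Complex.I * l).re ≤ t
  have h1' : (q : ℝ) ≤ p := by exact_mod_cast h1
  have h2' : (p : ℝ) ≤ q + 1 := by exact_mod_cast h2
  have e : (p : ℝ) / ((n + 1 : ℕ) : ℝ) - n / (n + 1) * (q / n) = (p - q) / (n + 1) := by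
    push_cast
    field_simp
  rw [e, abs_of_nonneg (div_nonneg (by linarith) (by positivity))]
  gcongr
  linarith

/-! ### Empirical characteristic functions -/

/-- The characteristic function at `s` of the empirical measure of the points
`∑ m, coef k m * z m`. -/
noncomputable def specChar (n : ℕ) (z : ℕ → ℝ) (s : ℝ) : ℂ :=
  (n : ℂ)⁻¹ * ∑ k : Fin n, Complex.exp ((s * ∑ m : Fin n, coef k m * z m : ℝ) * Complex.I)

theorem norm_exp_mul_I_sub_le (a b : ℝ) :
    ‖Complex.exp (a * Complex.I) - Complex.exp (b * Complex.I)‖ ≤ |a - b| := by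
  have h : Complex.exp (a * Complex.I) - Complex.exp (b * Complex.I) =
      Complex.exp (b * Complex.I) * (Complex.exp (Complex.I * ((a - b : ℝ) : ℂ)) - 1) := by
    rw [mul_sub, ← Complex.exp_add]
    push_cast
    ring_nf
  rw [h, norm_mul, Complex.norm_exp_ofReal_mul_I, one_mul]
  exact Real.norm_exp_I_mul_ofReal_sub_one_le

theorem norm_average_exp_sub_sq_le {n : ℕ} (a b : Fin n → ℝ) :
    ‖(n : ℂ)⁻¹ * ∑ k, Complex.exp (a k * Complex.I) -
      (n : ℂ)⁻¹ * ∑ k, Complex.exp (b k * Complex.I)‖ ^ 2 ≤ (n : ℝ)⁻¹ * ∑ k, (a k - b k) ^ 2 := by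
  rcases Nat.eq_zero_or_pos n with hn | hn
  · subst hn; simp
  have hnr : (0 : ℝ) < n := by exact_mod_cast hn
  rw [← mul_sub, ← Finset.sum_sub_distrib, norm_mul, norm_inv, Complex.norm_natCast, mul_pow]
  have h1 : ‖∑ k, (Complex.exp (a k * Complex.I) - Complex.exp (b k * Complex.I))‖ ≤
      ∑ k, |a k - b k| :=
    (norm_sum_le _ _).trans (Finset.sum_le_sum fun k _ => norm_exp_mul_I_sub_le _ _)
  have h2 : (∑ k, |a k - b k|) ^ 2 ≤ n * ∑ k, (a k - b k) ^ 2 := by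
    simpa using sq_sum_le_card_mul_sum_sq (s := Finset.univ) (f := fun k => |a k - b k|)
  calc _ ≤ (n : ℝ)⁻¹ ^ 2 * (∑ k, |a k - b k|) ^ 2 := by gcongr
    _ ≤ (n : ℝ)⁻¹ ^ 2 * (n * ∑ k, (a k - b k) ^ 2) := by gcongr
    _ = _ := by field_simp

/-- The empirical characteristic function is Lipschitz in the input, with the normalised Euclidean
norm. -/
theorem norm_specChar_sub_le (n : ℕ) (z w : ℕ → ℝ) (s : ℝ) :
    ‖specChar n z s - specChar n w s‖ ^ 2 ≤
      s ^ 2 * (2 / n * ∑ m ∈ Finset.range n, (z m - w m) ^ 2) := by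
  refine (norm_average_exp_sub_sq_le _ _).trans ?_
  have h1 : ∀ k : Fin n, (s * ∑ m : Fin n, coef k m * z m - s * ∑ m : Fin n, coef k m * w m) ^ 2
      = s ^ 2 * (∑ m : Fin n, coef k m * (z m - w m)) ^ 2 := by
    intro k
    rw [← mul_sub, ← Finset.sum_sub_distrib, mul_pow]
    simp only [mul_sub]
  rw [Finset.sum_congr rfl fun k _ => h1 k, ← Finset.mul_sum, mul_left_comm, Finset.sum_range]
  refine mul_le_mul_of_nonneg_left ?_ (sq_nonneg s)
  calc _ ≤ (n : ℝ)⁻¹ * (2 * ∑ m : Fin n, (z m - w m) ^ 2) := by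
        gcongr; exact sum_sq_coef_le fun m : Fin n => z m - w m
    _ = _ := by ring

theorem norm_specChar_sub_le' (n : ℕ) (z : ℕ → ℝ) (s r : ℝ) :
    ‖specChar n z s - specChar n z r‖ ^ 2 ≤
      (s - r) ^ 2 * (2 / n * ∑ m ∈ Finset.range n, z m ^ 2) := by
  refine (norm_average_exp_sub_sq_le _ _).trans ?_
  have h1 : ∀ k : Fin n, (s * ∑ m : Fin n, coef k m * z m - r * ∑ m : Fin n, coef k m * z m) ^ 2
      = (s - r) ^ 2 * (∑ m : Fin n, coef k m * z m) ^ 2 := by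
    intro k; ring
  rw [Finset.sum_congr rfl fun k _ => h1 k, ← Finset.mul_sum, mul_left_comm, Finset.sum_range]
  refine mul_le_mul_of_nonneg_left ?_ (sq_nonneg _)
  calc _ ≤ (n : ℝ)⁻¹ * (2 * ∑ m : Fin n, z m ^ 2) := by
        gcongr; exact sum_sq_coef_le fun m : Fin n => z m
    _ = _ := by ring

theorem norm_specChar_le (n : ℕ) (z : ℕ → ℝ) (s : ℝ) : ‖specChar n z s‖ ≤ 1 := by
  unfold specChar
  rcases Nat.eq_zero_or_pos n with hn | hn
  · subst hn; simp
  have hnr : (0 : ℝ) < n := by exact_mod_cast hn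
  rw [norm_mul, norm_inv, Complex.norm_natCast]
  calc _ ≤ (n : ℝ)⁻¹ * ∑ k : Fin n, 1 := by
        gcongr
        refine (norm_sum_le _ _).trans (Finset.sum_le_sum fun k _ => ?_)
        rw [Complex.norm_exp_ofReal_mul_I]
    _ = 1 := by simp; field_simp

theorem specChar_eq_specMean (n : ℕ) (z : ℕ → ℝ) (s : ℝ) :
    specChar n z s = (specMean (fun t => Real.cos (s * t)) (fun m : Fin n => z m) : ℂ) +
      (specMean (fun t => Real.sin (s * t)) (fun m : Fin n => z m) : ℂ) * Complex.I := by
  unfold specChar specMean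
  push_cast
  rw [mul_assoc, Finset.sum_mul, ← mul_add, ← Finset.sum_add_distrib]
  congr 1
  refine Finset.sum_congr rfl fun k _ => ?_
  rw [Complex.exp_mul_I]

theorem norm_exp_sub_sub_le (a b : ℝ) :
    ‖Complex.exp (b * Complex.I) - Complex.exp (a * Complex.I) -
      Complex.exp (a * Complex.I) * ((b - a : ℝ) * Complex.I)‖ ≤ 5 * (a - b) ^ 2 := by
  set h := b - a with hh
  have e : Complex.exp (b * Complex.I) =
      Complex.exp (a * Complex.I) * Complex.exp (h * Complex.I) := by
    rw [← Complex.exp_add, hh]; push_cast; ring_nf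
  have e2 : Complex.exp (b * Complex.I) - Complex.exp (a * Complex.I) -
      Complex.exp (a * Complex.I) * (h * Complex.I) = Complex.exp (a * Complex.I) *
      ((Complex.exp (h * Complex.I) - (1 + h * Complex.I - h ^ 2 / 2)) - h ^ 2 / 2) := by
    rw [e]; ring
  rw [e2, norm_mul, Complex.norm_exp_ofReal_mul_I, one_mul]
  refine (norm_sub_le _ _).trans ?_
  have h1 := (norm_exp_sub_taylor_le h).2
  have h2 : ‖((h : ℂ) ^ 2 / 2)‖ = h ^ 2 / 2 := by simp
  have h3 : (a - b) ^ 2 = h ^ 2 := by rw [hh]; ring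
  rw [h2, h3]
  nlinarith [sq_nonneg h]

theorem abs_cos_taylor_le (s a b : ℝ) :
    |Real.cos (s * a) - Real.cos (s * b) - (-s * Real.sin (s * a)) * (a - b)| ≤
      (|s| + 5 * s ^ 2) * (a - b) ^ 2 := by
  have h := (Complex.abs_re_le_norm _).trans (norm_exp_sub_sub_le (s * a) (s * b))
  simp only [Complex.sub_re, Complex.mul_re, Complex.exp_ofReal_mul_I_re, Complex.I_re,
    Complex.exp_ofReal_mul_I_im, Complex.mul_im, Complex.ofReal_re, Complex.ofReal_im,
    Complex.I_im] at h
  rw [abs_sub_comm] at h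
  have e : (s * a - s * b) ^ 2 = s ^ 2 * (a - b) ^ 2 := by ring
  rw [e] at h
  have h' : 0 ≤ |s| * (a - b) ^ 2 := by positivity
  refine le_trans (le_of_eq ?_) (h.trans (by linarith))
  congr 1
  ring

theorem abs_sin_taylor_le (s a b : ℝ) :
    |Real.sin (s * a) - Real.sin (s * b) - (s * Real.cos (s * a)) * (a - b)| ≤
      (|s| + 5 * s ^ 2) * (a - b) ^ 2 := by
  have h := (Complex.abs_im_le_norm _).trans (norm_exp_sub_sub_le (s * a) (s * b))
  simp only [Complex.sub_im, Complex.mul_re, Complex.exp_ofReal_mul_I_re, Complex.I_re,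
    Complex.exp_ofReal_mul_I_im, Complex.mul_im, Complex.ofReal_re, Complex.ofReal_im,
    Complex.I_im] at h
  have e : (s * a - s * b) ^ 2 = s ^ 2 * (a - b) ^ 2 := by ring
  rw [e] at h
  have h' : 0 ≤ |s| * (a - b) ^ 2 := by positivity
  refine le_trans (le_of_eq ?_) (h.trans (by linarith))
  rw [← abs_neg]
  congr 1
  ring

theorem measurable_specChar {Ω : Type*} [MeasurableSpace Ω] {y : ℕ → Ω → ℝ}
    (hm : ∀ i, Measurable (y i)) (n : ℕ) (s : ℝ) :
    Measurable fun ω => specChar n (fun i => y i ω) s := by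
  unfold specChar
  fun_prop

theorem integrable_specChar {Ω : Type*} [MeasurableSpace Ω] {P : Measure Ω} [IsFiniteMeasure P]
    {y : ℕ → Ω → ℝ} (hm : ∀ i, Measurable (y i)) (n : ℕ) (s : ℝ) :
    Integrable (fun ω => specChar n (fun i => y i ω) s) P :=
  Integrable.of_bound (measurable_specChar hm n s).aestronglyMeasurable 1
    (ae_of_all _ fun _ => norm_specChar_le _ _ _)

theorem ae_tendsto_specChar_sub {Ω : Type*} [MeasurableSpace Ω] {P : Measure Ω}
    [IsProbabilityMeasure P] {y : ℕ → Ω → ℝ} (hm : ∀ i, Measurable (y i)) (hy : iIndepFun y P)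
    {C : ℝ} (hC : ∀ i ω, |y i ω| ≤ C) (s : ℝ) :
    ∀ᵐ ω ∂P, Tendsto (fun n : ℕ => specChar n (fun i => y i ω) s
      - ∫ ω', specChar n (fun i => y i ω') s ∂P) atTop (𝓝 0) := by
  have hb : ∀ t : ℝ, |t| ≤ 1 → |s * t| ≤ |s| + 5 * s ^ 2 := fun t ht => by
    rw [abs_mul]
    nlinarith [abs_nonneg s, sq_nonneg s]
  have hc := ae_tendsto_specMean_sub hm hy hC (φ := fun t => Real.cos (s * t))
    (φ' := fun t => -s * Real.sin (s * t)) (K := |s| + 5 * s ^ 2) (by fun_prop)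
    (fun t => Real.abs_cos_le_one _)
    (fun t => by rw [neg_mul, abs_neg]; exact hb _ (Real.abs_sin_le_one _))
    (abs_cos_taylor_le s)
  have hs := ae_tendsto_specMean_sub hm hy hC (φ := fun t => Real.sin (s * t))
    (φ' := fun t => s * Real.cos (s * t)) (K := |s| + 5 * s ^ 2) (by fun_prop)
    (fun t => Real.abs_sin_le_one _)
    (fun t => hb _ (Real.abs_cos_le_one _)) (abs_sin_taylor_le s)
  have hint : ∀ (φ : ℝ → ℝ), Measurable φ → (∀ t, |φ t| ≤ 1) → ∀ n : ℕ,
      Integrable (fun ω => specMean φ (fun m : Fin n => y m ω)) P := fun φ hφ h1 n =>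
    integrable_of_abs_le ((measurable_specMean hφ).comp
      (measurable_pi_lambda _ fun m : Fin n => hm m)) fun ω => abs_specMean_le h1 _
  filter_upwards [hc, hs] with ω h1 h2
  have h3 := ((Complex.continuous_ofReal.tendsto 0).comp h1).add
    (((Complex.continuous_ofReal.tendsto 0).comp h2).mul_const Complex.I)
  simp only [Complex.ofReal_zero, zero_mul, add_zero] at h3
  refine h3.congr fun n => ?_
  simp only [specChar_eq_specMean, Function.comp_apply]
  rw [integral_add (hint _ (by fun_prop) (fun t => Real.abs_cos_le_one _) n).ofReal
    ((hint _ (by fun_prop) (fun t => Real.abs_sin_le_one _) n).ofReal.mul_const _),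
    integral_mul_const, integral_complex_ofReal, integral_complex_ofReal]
  push_cast
  ring

theorem norm_integral_specChar_sub_le {Ω : Type*} [MeasurableSpace Ω] {P : Measure Ω}
    [IsProbabilityMeasure P] {x : ℕ → Ω → ℝ} (hx : IsInput P x) {C ε : ℝ} (hC : 0 ≤ C)
    (hε : ∀ i, ∫ ω, tail C (x i ω) ^ 2 ∂P ≤ ε) (s : ℝ) {n : ℕ} (hn : 0 < n) :
    ‖∫ ω, specChar n (fun i => x i ω) s ∂P - Real.exp (-(s ^ 2 / 2))‖ ≤
      s ^ 2 * (4 * (C * (|s| * (2 / Real.sqrt n)) + ε) + s ^ 2 / n + 1 / n) + 2 / n := by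
  have hnr : (0 : ℝ) < n := by exact_mod_cast hn
  have hnc : (n : ℂ) ≠ 0 := by exact_mod_cast hn.ne'
  have hε0 : 0 ≤ ε := (integral_nonneg fun ω => sq_nonneg _).trans (hε 0)
  set e : ℂ := ((Real.exp (-(s ^ 2 / 2)) : ℝ) : ℂ) with he
  set b := s ^ 2 * (4 * (C * (|s| * (2 / Real.sqrt n)) + ε) + s ^ 2 / n + 1 / n) with hb
  have hb0 : 0 ≤ b := by positivity
  set c : Fin n → ℂ := fun k =>
    ∫ ω, Complex.exp ((s * ∑ m : Fin n, coef k m * x m ω : ℝ) * Complex.I) ∂P with hc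
  have hm := hx.measurable
  have hint : ∀ k : Fin n, Integrable (fun ω =>
      Complex.exp ((s * ∑ m : Fin n, coef k m * x m ω : ℝ) * Complex.I)) P := fun k =>
    Integrable.of_bound (by
      refine Measurable.aestronglyMeasurable ?_
      fun_prop) 1 (ae_of_all _ fun ω => by rw [Complex.norm_exp_ofReal_mul_I])
  have h1 : ∫ ω, specChar n (fun i => x i ω) s ∂P - e = (n : ℂ)⁻¹ * ∑ k, (c k - e) := by
    unfold specChar
    rw [integral_const_mul, integral_finsetSum _ fun k _ => hint k, Finset.sum_sub_distrib]
    simp only [Finset.sum_const, Finset.card_univ, Fintype.card_fin, nsmul_eq_mul, mul_sub]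
    rw [inv_mul_cancel_left₀ hnc]
  have h2 : ∀ k : Fin n, ‖c k - e‖ ≤ b + if 2 * (k : ℕ) + 1 = n then 2 else 0 := by
    intro k
    split_ifs with hk
    · refine (norm_sub_le _ _).trans ?_
      have h3 : ‖c k‖ ≤ 1 := by
        have := norm_integral_le_of_norm_le_const (μ := P) (C := 1)
          (f := fun ω => Complex.exp ((s * ∑ m : Fin n, coef k m * x m ω : ℝ) * Complex.I))
          (ae_of_all _ fun ω => by rw [Complex.norm_exp_ofReal_mul_I])
        simpa only [probReal_univ, mul_one] using this
      have h4 : ‖e‖ ≤ 1 := by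
        rw [he, Complex.norm_real, Real.norm_eq_abs, abs_of_pos (Real.exp_pos _)]
        exact Real.exp_le_one_iff.2 (by have := sq_nonneg s; linarith)
      linarith
    · rw [add_zero]
      exact norm_charFun_point_sub_le hx hC hε s hk
  have hcard : ∑ k : Fin n, (if 2 * (k : ℕ) + 1 = n then (2 : ℝ) else 0) ≤ 2 := by
    rw [← Finset.sum_filter, Finset.sum_const, nsmul_eq_mul]
    have : (Finset.univ.filter fun k : Fin n => 2 * (k : ℕ) + 1 = n).card ≤ 1 := by
      rw [Finset.card_le_one]
      intro a ha b hb
      simp only [Finset.mem_filter] at ha hb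
      ext
      omega
    have : ((Finset.univ.filter fun k : Fin n => 2 * (k : ℕ) + 1 = n).card : ℝ) ≤ 1 := by
      exact_mod_cast this
    linarith
  rw [h1, norm_mul, norm_inv, Complex.norm_natCast]
  calc _ ≤ (n : ℝ)⁻¹ * ∑ k : Fin n, (b + if 2 * (k : ℕ) + 1 = n then 2 else 0) := by
        gcongr
        exact (norm_sum_le _ _).trans (Finset.sum_le_sum fun k _ => h2 k)
    _ ≤ (n : ℝ)⁻¹ * (n * b + 2) := by
        gcongr
        rw [Finset.sum_add_distrib]
        simp only [Finset.sum_const, Finset.card_univ, Fintype.card_fin, nsmul_eq_mul]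
        linarith
    _ = _ := by field_simp

/-! ### Almost sure convergence -/

/-- The empirical characteristic function at `s` is compared with that of the truncated input, which
concentrates at its mean; this mean is compared with the mean for the original input, which the
central limit theorem identifies. -/
theorem ae_tendsto_specChar {Ω : Type*} [MeasurableSpace Ω] {P : Measure Ω}
    [IsProbabilityMeasure P] {x : ℕ → Ω → ℝ} (hx : IsInput P x) (ht : TailControl P x) (s : ℝ) :
    ∀ᵐ ω ∂P, Tendsto (fun n : ℕ => specChar n (fun i => x i ω) s) atTop
      (𝓝 (Real.exp (-(s ^ 2 / 2)) : ℝ)) := by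
  -- the total error at truncation level `ε`
  set δ : ℝ → ℝ := fun ε => 2 * Real.sqrt (s ^ 2 * (2 * ε)) + (s ^ 2 * (4 * ε) + 2 * ε) with hδ
  have hδ0 : Tendsto δ (𝓝 0) (𝓝 0) := by
    have : Continuous δ := by fun_prop
    simpa [hδ] using this.tendsto 0
  have main : ∀ ε : ℝ, 0 < ε → ∀ᵐ ω ∂P, ∀ᶠ n : ℕ in atTop,
      ‖specChar n (fun i => x i ω) s - (Real.exp (-(s ^ 2 / 2)) : ℝ)‖ ≤ δ ε := by
    intro ε hε
    obtain ⟨C, hC0, hCm, hCa⟩ := ht ε hε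
    set y : ℕ → Ω → ℝ := fun i ω => x i ω - tail C (x i ω) with hy
    have hcut : Measurable fun t : ℝ => t - tail C t := measurable_id.sub (measurable_tail C)
    have hym : ∀ i, Measurable (y i) := fun i => hcut.comp (hx.measurable i)
    have hyi : iIndepFun y P := hx.indep.comp (fun _ t => t - tail C t) fun _ => hcut
    have hyC : ∀ i ω, |y i ω| ≤ C := by
      intro i ω
      simp only [hy, tail]
      split_ifs with h
      · simpa using h
      · simpa using hC0
    have hdiff : ∀ (n : ℕ) ω, ‖specChar n (fun i => x i ω) s - specChar n (fun i => y i ω) s‖ ^ 2 ≤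
        s ^ 2 * (2 / n * ∑ m ∈ Finset.range n, tail C (x m ω) ^ 2) := by
      intro n ω
      refine (norm_specChar_sub_le n _ _ s).trans (le_of_eq ?_)
      simp [hy]
    -- the means of the spectral statistics of the original and of the truncated variables
    have hmean : ∀ n : ℕ, 0 < n → ‖∫ ω, specChar n (fun i => y i ω) s ∂P -
        ∫ ω, specChar n (fun i => x i ω) s ∂P‖ ≤ Real.sqrt (s ^ 2 * (2 * ε)) := by
      intro n hn
      have hnr : (0 : ℝ) < n := by exact_mod_cast hn
      have ix := integrable_specChar (P := P) hx.measurable n s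
      have iy := integrable_specChar (P := P) hym n s
      set g : Ω → ℝ := fun ω =>
        ‖specChar n (fun i => x i ω) s - specChar n (fun i => y i ω) s‖ with hg
      have ig : Integrable g P := (ix.sub iy).norm
      have gm : Measurable g :=
        ((measurable_specChar hx.measurable n s).sub (measurable_specChar hym n s)).norm
      have ig2 : Integrable (fun ω => g ω ^ 2) P := by
        refine integrable_of_abs_le (B := 2 ^ 2) (gm.pow_const 2) fun ω => ?_
        rw [abs_pow]
        refine pow_le_pow_left₀ (abs_nonneg _) ?_ 2
        rw [abs_of_nonneg (norm_nonneg _)]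
        exact (norm_sub_le _ _).trans (by
          linarith [norm_specChar_le n (fun i => x i ω) s, norm_specChar_le n (fun i => y i ω) s])
      have it : ∀ m, Integrable (fun ω => tail C (x m ω) ^ 2) P := fun m =>
        integrable_tail_sq (hx.measurable m) (hx.memLp_two m) C
      have hsq : (∫ ω, g ω ∂P) ^ 2 ≤ s ^ 2 * (2 * ε) := by
        refine (sq_integral_le ig ig2).trans ?_
        refine (integral_mono ig2
          (((integrable_finsetSum _ fun m _ => it m).const_mul _).const_mul _)
          (hdiff n)).trans ?_
        rw [integral_const_mul, integral_const_mul, integral_finsetSum _ fun m _ => it m]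
        refine mul_le_mul_of_nonneg_left ?_ (sq_nonneg s)
        have : ∑ m ∈ Finset.range n, ∫ ω, tail C (x m ω) ^ 2 ∂P ≤ n * ε := by
          refine (Finset.sum_le_sum fun m _ => hCm m).trans ?_
          simp
        calc _ ≤ 2 / (n : ℝ) * (n * ε) := by gcongr
          _ = _ := by field_simp
      rw [norm_sub_rev, ← integral_sub ix iy]
      exact (norm_integral_le_integral_norm _).trans (Real.le_sqrt_of_sq_le hsq)
    -- the mean of the spectral statistic of the original variables
    have hclt : ∀ᶠ n : ℕ in atTop, ‖∫ ω, specChar n (fun i => x i ω) s ∂P -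
        (Real.exp (-(s ^ 2 / 2)) : ℝ)‖ ≤ s ^ 2 * (4 * ε) + ε := by
      have h1 : Tendsto (fun n : ℕ => (n : ℝ)⁻¹) atTop (𝓝 0) := tendsto_inv_atTop_nhds_zero_nat
      have h2 : Tendsto (fun n : ℕ => (Real.sqrt n)⁻¹) atTop (𝓝 0) :=
        (Real.tendsto_sqrt_atTop.comp tendsto_natCast_atTop_atTop).inv_tendsto_atTop
      have hcont : Continuous fun q : ℝ × ℝ =>
        s ^ 2 * (4 * (C * (|s| * (2 * q.2)) + ε) + s ^ 2 * q.1 + 1 * q.1) + 2 * q.1 := by fun_prop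
      have hlim := (hcont.tendsto (0, 0)).comp (h1.prodMk_nhds h2)
      have hlt : s ^ 2 * (4 * (C * (|s| * (2 * (0 : ℝ))) + ε) + s ^ 2 * 0 + 1 * 0) + 2 * 0 <
          s ^ 2 * (4 * ε) + ε := by
        simp only [mul_zero, add_zero, zero_add]
        linarith
      filter_upwards [hlim.eventually (gt_mem_nhds hlt), eventually_gt_atTop 0] with n hn hn0
      refine (norm_integral_specChar_sub_le hx hC0 hCm s hn0).trans ?_
      simp only [Function.comp_apply, ← div_eq_mul_inv] at hn
      exact hn.le
    filter_upwards [ae_tendsto_specChar_sub hym hyi hyC s, hCa] with ω h1 h2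
    filter_upwards [h2, hclt, eventually_gt_atTop 0,
      (tendsto_zero_iff_norm_tendsto_zero.1 h1).eventually (gt_mem_nhds hε)] with n e1 e2 hn e3
    have hnr : (0 : ℝ) < n := by exact_mod_cast hn
    have e4 : ‖specChar n (fun i => x i ω) s - specChar n (fun i => y i ω) s‖ ≤
        Real.sqrt (s ^ 2 * (2 * ε)) := by
      refine Real.le_sqrt_of_sq_le ((hdiff n ω).trans ?_)
      refine mul_le_mul_of_nonneg_left ?_ (sq_nonneg s)
      calc _ ≤ 2 / (n : ℝ) * (ε * n) := by gcongr
        _ = _ := by field_simp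
    have e5 := hmean n hn
    have split : specChar n (fun i => x i ω) s - ((Real.exp (-(s ^ 2 / 2)) : ℝ) : ℂ) =
        ((specChar n (fun i => x i ω) s - specChar n (fun i => y i ω) s) +
        (specChar n (fun i => y i ω) s - ∫ ω, specChar n (fun i => y i ω) s ∂P)) +
        ((∫ ω, specChar n (fun i => y i ω) s ∂P - ∫ ω, specChar n (fun i => x i ω) s ∂P) +
        (∫ ω, specChar n (fun i => x i ω) s ∂P - ((Real.exp (-(s ^ 2 / 2)) : ℝ) : ℂ))) := by
      ring
    rw [split]
    refine (norm_add_le _ _).trans ?_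
    have f1 := norm_add_le (specChar n (fun i => x i ω) s - specChar n (fun i => y i ω) s)
      (specChar n (fun i => y i ω) s - ∫ ω, specChar n (fun i => y i ω) s ∂P)
    have f2 := norm_add_le
      (∫ ω, specChar n (fun i => y i ω) s ∂P - ∫ ω, specChar n (fun i => x i ω) s ∂P)
      (∫ ω, specChar n (fun i => x i ω) s ∂P - ((Real.exp (-(s ^ 2 / 2)) : ℝ) : ℂ))
    simp only [hδ]
    linarith
  have hall : ∀ᵐ ω ∂P, ∀ j : ℕ, ∀ᶠ n : ℕ in atTop,
      ‖specChar n (fun i => x i ω) s - (Real.exp (-(s ^ 2 / 2)) : ℝ)‖ ≤ δ (1 / ((j : ℝ) + 1)) :=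
    ae_all_iff.2 fun j => main _ Nat.one_div_pos_of_nat
  filter_upwards [hall] with ω hω
  rw [tendsto_iff_norm_sub_tendsto_zero]
  rw [Metric.tendsto_atTop]
  intro η hη
  obtain ⟨j, hj⟩ := ((hδ0.comp tendsto_one_div_add_atTop_nhds_zero_nat).eventually
    (gt_mem_nhds hη)).exists
  obtain ⟨N, hN⟩ := eventually_atTop.1 (hω j)
  refine ⟨N, fun n hn => ?_⟩
  rw [Real.dist_eq, sub_zero, abs_of_nonneg (norm_nonneg _)]
  exact (hN n hn).trans_lt hj

theorem TailControl.ae_sum_sq_le {Ω : Type*} [MeasurableSpace Ω] {P : Measure Ω}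
    {x : ℕ → Ω → ℝ} (ht : TailControl P x) :
    ∃ B : ℝ, ∀ᵐ ω ∂P, ∀ᶠ n : ℕ in atTop, ∑ m ∈ Finset.range n, x m ω ^ 2 ≤ B * n := by
  obtain ⟨C, hC0, -, hCa⟩ := ht 1 one_pos
  refine ⟨C ^ 2 + 1, ?_⟩
  filter_upwards [hCa] with ω hω
  filter_upwards [hω] with n hn
  have : ∀ t, t ^ 2 ≤ C ^ 2 + tail C t ^ 2 := by
    intro t
    unfold tail
    split_ifs with h
    · rw [← sq_abs t]
      have := pow_le_pow_left₀ (abs_nonneg t) h 2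
      simpa using this
    · have := sq_nonneg C; linarith
  calc _ ≤ ∑ m ∈ Finset.range n, (C ^ 2 + tail C (x m ω) ^ 2) :=
        Finset.sum_le_sum fun m _ => this _
    _ = n * C ^ 2 + ∑ m ∈ Finset.range n, tail C (x m ω) ^ 2 := by
        rw [Finset.sum_add_distrib]; simp
    _ ≤ _ := by linarith

/-- Almost surely the characteristic functions converge everywhere: they are Lipschitz in `s` with a
constant that is almost surely bounded in `n`, so that convergence at rational `s` is enough. -/
theorem ae_forall_tendsto_specChar {Ω : Type*} [MeasurableSpace Ω] {P : Measure Ω}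
    [IsProbabilityMeasure P] {x : ℕ → Ω → ℝ} (hx : IsInput P x) (ht : TailControl P x) :
    ∀ᵐ ω ∂P, ∀ s : ℝ, Tendsto (fun n : ℕ => specChar n (fun i => x i ω) s) atTop
      (𝓝 (Real.exp (-(s ^ 2 / 2)) : ℝ)) := by
  obtain ⟨B, hB⟩ := ht.ae_sum_sq_le
  filter_upwards [ae_all_iff.2 fun q : ℚ => ae_tendsto_specChar hx ht q, hB] with ω h1 h2 s
  have hc1 : Continuous fun q : ℝ => Real.sqrt ((s - q) ^ 2 * (2 * B)) := by fun_prop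
  have hc2 : Continuous fun q : ℝ => ((Real.exp (-(q ^ 2 / 2)) : ℝ) : ℂ) := by fun_prop
  rw [Metric.tendsto_atTop]
  intro η hη
  have hev : ∀ᶠ q : ℝ in 𝓝 s, Real.sqrt ((s - q) ^ 2 * (2 * B)) < η / 3 ∧
      dist ((Real.exp (-(q ^ 2 / 2)) : ℝ) : ℂ) ((Real.exp (-(s ^ 2 / 2)) : ℝ) : ℂ) < η / 3 := by
    refine (hc1.tendsto s |>.eventually (gt_mem_nhds ?_)).and
      ((hc2.tendsto s).eventually (Metric.ball_mem_nhds _ (by positivity)))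
    simp only [sub_self]
    norm_num
    exact hη
  obtain ⟨U, hU, hUo, hsU⟩ := eventually_nhds_iff.1 hev
  obtain ⟨q, hq⟩ := Rat.denseRange_cast.exists_mem_open hUo ⟨s, hsU⟩
  obtain ⟨hq1, hq2⟩ := hU _ hq
  obtain ⟨N, hN⟩ := Metric.tendsto_atTop.1 (h1 q) (η / 3) (by positivity)
  obtain ⟨M, hM⟩ := eventually_atTop.1 h2
  refine ⟨max (max N M) 1, fun n hn => ?_⟩
  have hnN : N ≤ n := (le_max_left _ _).trans ((le_max_left _ _).trans hn)
  have hnM : M ≤ n := (le_max_right _ _).trans ((le_max_left _ _).trans hn)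
  have hnr : (0 : ℝ) < n := by exact_mod_cast (le_max_right _ _).trans hn
  have e1 : dist (specChar n (fun i => x i ω) s) (specChar n (fun i => x i ω) q) < η / 3 := by
    rw [dist_eq_norm]
    refine lt_of_le_of_lt (Real.le_sqrt_of_sq_le ?_) hq1
    refine (norm_specChar_sub_le' n _ s q).trans ?_
    refine mul_le_mul_of_nonneg_left ?_ (sq_nonneg _)
    calc _ ≤ 2 / (n : ℝ) * (B * n) := by gcongr; exact hM n hnM
      _ = _ := by field_simp
  have e2 := hN n hnN
  have t1 := dist_triangle (specChar n (fun i => x i ω) s) (specChar n (fun i => x i ω) q)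
    ((Real.exp (-(s ^ 2 / 2)) : ℝ) : ℂ)
  have t2 := dist_triangle (specChar n (fun i => x i ω) q)
    ((Real.exp (-((q : ℝ) ^ 2 / 2)) : ℝ) : ℂ) ((Real.exp (-(s ^ 2 / 2)) : ℝ) : ℂ)
  linarith

/-- The empirical measure of the spectrum of `scaledSkewSC a (n + 1)`, rotated onto the real
axis. -/
noncomputable def specMeasure (a : ℕ → ℝ) (n : ℕ) : Measure ℝ :=
  ((n + 1 : ℕ) : ENNReal)⁻¹ •
    ∑ k : Fin (n + 1), Measure.dirac (∑ m : Fin (n + 1), coef k m * a m)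

instance (a : ℕ → ℝ) (n : ℕ) : IsProbabilityMeasure (specMeasure a n) := by
  constructor
  simp only [specMeasure, Measure.smul_apply, Measure.finsetSum_apply, measure_univ, smul_eq_mul,
    Finset.sum_const, Finset.card_univ, Fintype.card_fin, nsmul_eq_mul, mul_one]
  exact ENNReal.inv_mul_cancel (by simp) (by simp)

theorem charFun_specMeasure (a : ℕ → ℝ) (n : ℕ) (s : ℝ) :
    charFun (specMeasure a n) s = specChar (n + 1) a s := by
  rw [charFun_apply_real, specMeasure, integral_smul_measure, integral_finsetSum_measure]
  · simp only [integral_dirac, specChar, ENNReal.toReal_inv, ENNReal.toReal_natCast]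
    rw [Complex.real_smul]
    push_cast
    rfl
  · intro k _
    exact integrable_dirac (by simp)

theorem specMeasure_real_Iic (a : ℕ → ℝ) (n : ℕ) (t : ℝ) :
    (specMeasure a n).real (Set.Iic t) = skewESD (scaledSkewSC a (n + 1)) t := by
  rw [skewESD_scaledSkewSC, specMeasure, measureReal_def, Measure.smul_apply,
    Measure.finsetSum_apply, smul_eq_mul, ENNReal.toReal_mul, ENNReal.toReal_inv,
    ENNReal.toReal_natCast, ENNReal.toReal_sum (fun k _ => measure_ne_top _ _), div_eq_inv_mul]
  congr 1
  rw [← Finset.sum_boole]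
  refine Finset.sum_congr rfl fun k _ => ?_
  rw [Measure.dirac_apply' _ measurableSet_Iic, Set.indicator_apply]
  simp only [Set.mem_Iic, Pi.one_apply]
  split_ifs <;> simp

theorem tendsto_skewESD_of_tendsto_specChar {a : ℕ → ℝ}
    (h : ∀ s : ℝ, Tendsto (fun n : ℕ => specChar n a s) atTop
      (𝓝 (Real.exp (-(s ^ 2 / 2)) : ℝ))) (t : ℝ) :
    Tendsto (fun n : ℕ => skewESD (scaledSkewSC a n) t) atTop (𝓝 (cdf (gaussianReal 0 1) t)) := by
  have : NullSingletonClass (gaussianReal 0 1) := nullSingletonClass_gaussianReal one_ne_zero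
  rw [← tendsto_add_atTop_iff_nat 1]
  let μ : ℕ → ProbabilityMeasure ℝ := fun n => ⟨specMeasure a n, inferInstance⟩
  let γ : ProbabilityMeasure ℝ := ⟨gaussianReal 0 1, inferInstance⟩
  have hweak : Tendsto μ atTop (𝓝 γ) := by
    refine ProbabilityMeasure.tendsto_of_tendsto_charFun fun s => ?_
    have h1 := (tendsto_add_atTop_iff_nat 1).2 (h s)
    have e : charFun (gaussianReal 0 1) s = ((Real.exp (-(s ^ 2 / 2)) : ℝ) : ℂ) := by
      rw [charFun_gaussianReal]
      push_cast
      congr 1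
      simp
    change Tendsto (fun n => charFun (specMeasure a n) s) atTop (𝓝 (charFun (gaussianReal 0 1) s))
    simp only [charFun_specMeasure, e]
    exact h1
  have h2 := ProbabilityMeasure.tendsto_measure_of_null_frontier_of_tendsto' hweak
    (E := Set.Iic t) (by
      change gaussianReal 0 1 (frontier (Set.Iic t)) = 0
      simp)
  have h3 := (ENNReal.tendsto_toReal (measure_ne_top (gaussianReal 0 1) _)).comp h2
  rw [cdf_eq_real]
  refine h3.congr fun n => ?_
  exact specMeasure_real_Iic a n t

theorem monotone_skewESD {n : ℕ} (A : Matrix (Fin n) (Fin n) ℝ) : Monotone (skewESD A) := by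
  intro s t hst
  unfold skewESD
  gcongr
  simp only [Multiset.countP_eq_card_filter]
  exact Multiset.card_le_card (Multiset.monotone_filter_right _ fun l hl => le_trans hl hst)

/-- Interlacing compares the Toeplitz counting function at `t` with the circulant one at a point
tending to `t`; monotonicity and continuity of the limit absorb this shift. -/
theorem tendsto_skewESD_scaledSkewPT {a : ℕ → ℝ} {F : ℝ → ℝ}
    (h : ∀ t, Tendsto (fun n : ℕ => skewESD (scaledSkewSC a n) t) atTop (𝓝 (F t))) {t : ℝ}
    (hF : ContinuousAt F t) :
    Tendsto (fun n : ℕ => skewESD (scaledSkewPT a n) t) atTop (𝓝 (F t)) := by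
  rw [← tendsto_add_atTop_iff_nat 1]
  have hone : Tendsto (fun n : ℕ => (1 : ℝ) / ((n : ℝ) + 1)) atTop (𝓝 0) :=
    tendsto_one_div_add_atTop_nhds_zero_nat
  have hfrac : Tendsto (fun n : ℕ => (n : ℝ) / ((n : ℝ) + 1)) atTop (𝓝 1) :=
    tendsto_natCast_div_add_atTop 1
  have hscale : Tendsto (fun n : ℕ => t * (Real.sqrt (n + 1) / Real.sqrt n)) atTop (𝓝 t) := by
    have h1 := (Real.continuous_sqrt.tendsto 1).comp hfrac
    have h2 := (h1.inv₀ (by simp)).const_mul t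
    simp only [Real.sqrt_one, inv_one, mul_one] at h2
    refine h2.congr fun n => ?_
    simp only [Function.comp_apply]
    rw [Real.sqrt_div (Nat.cast_nonneg n), inv_div]
  have hmid : Tendsto (fun n : ℕ =>
      skewESD (scaledSkewSC a n) (t * (Real.sqrt (n + 1) / Real.sqrt n))) atTop (𝓝 (F t)) := by
    rw [Metric.tendsto_nhds]
    intro ε hε
    obtain ⟨δ, hδ, hδF⟩ := Metric.continuousAt_iff.1 hF (ε / 2) (by positivity)
    have hl := hδF (x := t - δ / 2) (by
      rw [Real.dist_eq, abs_lt]; constructor <;> linarith)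
    have hr := hδF (x := t + δ / 2) (by
      rw [Real.dist_eq, abs_lt]; constructor <;> linarith)
    filter_upwards [(Metric.tendsto_nhds.1 (h (t - δ / 2))) (ε / 2) (by positivity),
      (Metric.tendsto_nhds.1 (h (t + δ / 2))) (ε / 2) (by positivity),
      (Metric.tendsto_nhds.1 hscale) (δ / 2) (by positivity)] with n e1 e2 e3
    rw [Real.dist_eq, abs_lt] at e1 e2 e3 hl hr ⊢
    have m1 := monotone_skewESD (scaledSkewSC a n)
      (show t - δ / 2 ≤ t * (Real.sqrt (n + 1) / Real.sqrt n) by linarith)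
    have m2 := monotone_skewESD (scaledSkewSC a n)
      (show t * (Real.sqrt (n + 1) / Real.sqrt n) ≤ t + δ / 2 by linarith)
    constructor <;> linarith
  have hprod := hfrac.mul hmid
  rw [one_mul] at hprod
  have hdiff : Tendsto (fun n : ℕ => skewESD (scaledSkewPT a (n + 1)) t - n / (n + 1) *
      skewESD (scaledSkewSC a n) (t * (Real.sqrt (n + 1) / Real.sqrt n))) atTop (𝓝 0) := by
    refine squeeze_zero_norm' ?_ hone
    filter_upwards [eventually_gt_atTop 0] with n hn
    exact abs_skewESD_scaledSkewPT_sub_le a hn t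
  have := hdiff.add hprod
  rw [zero_add] at this
  exact this.congr fun n => by ring

end SkewLSD


theorem mainTheorem3 {Ω : Type*} [MeasurableSpace Ω] (P : Measure Ω) [IsProbabilityMeasure P]
    (x : ℕ → Ω → ℝ) (hx : SkewLSD.A1 P x ∨ SkewLSD.A2 P x ∨ SkewLSD.A3 P x) :
    SkewLSD.HasLSD P (fun n ω => SkewLSD.scaledSkewSC (fun i => x i ω) n) (gaussianReal 0 1) ∧
    SkewLSD.HasLSD P (fun n ω => SkewLSD.scaledSkewPT (fun i => x i ω) n) (gaussianReal 0 1) := by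
  have hin : SkewLSD.IsInput P x := by
    rcases hx with h | h | h <;> exact h.1
  have htail : SkewLSD.TailControl P x := by
    rcases hx with h | h | h
    · exact h.a3.tailControl
    · exact h.tailControl
    · exact h.tailControl
  have hae := SkewLSD.ae_forall_tendsto_specChar hin htail
  constructor
  · filter_upwards [hae] with ω hω t _
    exact SkewLSD.tendsto_skewESD_of_tendsto_specChar hω t
  · filter_upwards [hae] with ω hω t ht
    exact SkewLSD.tendsto_skewESD_scaledSkewPT
      (SkewLSD.tendsto_skewESD_of_tendsto_specChar hω) ht
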